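/- Case $n=2$, $l=1$. Consider the equation $-\Delta u+Vu+\sigma|u|^2u=\lambda u$ in $\mathbb R^2$ with the quasiperiodic conditions $u(x+2\pi e_i)=e^{2\pi i t_i}u(x)$, $\partial_iu(x+2\pi e_i)=e^{2\pi i t_i}\partial_iu(x)$ ($i=1,2$), where $\sigma\in\mathbb R$ and $V(x)=\sum_n v_ne^{i\langle n,x\rangle}$ is a real trigonometric polynomial over $\mathbb Z^2$ with $v_0=0$. For a $2\pi$-periodic $W$ with Fourier coefficients $w_n$ put $\|W\|_*=\sum_n|w_n|$. Quasimomenta $t$ are taken modulo $\mathbb Z^2$, with cell $K=[0,1)^2$; put $P_j(t)=j+t$ and $p_j(t)=|P_j(t)|$ for $j\in\mathbb Z^2$, and let $H_0(t)$ be $-\Delta$ with the quasiperiodic conditions. Resonant set: for $q\in\mathbb Z^2$, $\chi_q(k,\varepsilon)$ is the set of all $t\in K$ for which there is a unique $j$ with $p_j(t)=k$, and for this $j$: $|p_{j-q}^2(t)-p_j^2(t)|<\varepsilon$, and $|p_j^2(t)-p_m^2(t)|>2\varepsilon^6$ and $|p_{j-q}^2(t)-p_m^2(t)|>2\varepsilon^6$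 for all $m\ne j,j-q$. In a neighborhood of $\chi_q(k,\varepsilon)$ the index $j$ is that of a nearby point of $\chi_q(k,\varepsilon)$, and $\hat\lambda^{\pm}(t)$ are the eigenvalues, $\hat\lambda^+\ge\hat\lambda^-$, of $$\begin{pmatrix}p_j^2(t)&v_q\\ \overline{v_q}&p_{j-q}^2(t)\end{pmatrix}.$$ Resonant solutions: fix a sign $\pm$ and $A\in\mathbb C$. For a periodic $W$ let $E_W$ be the spectral projection of $H_0(t)+W$ for the disk of radius $\varepsilon^{10}/4$ about $\hat\lambda^{\pm}(t)$, written as a matrix in the basis $e^{i\langle P_m(t),x\rangle}$, and $u_W(x)=A\sum_m(E_W)_{mj}e^{i\langle P_m(t),x\rangle}$. Put $W_0=V$, $W_{m+1}=V+\sigma|u_{W_m}|^2$; let $W$ be the limit of $W_m$ in $\|\cdot\|_*$, $\lambda(t)=\lambda^{\pm}(t)$ the eigenvalue of $H_0(t)+W$ in that disk, and $u=u_W$. Theorem. There are absolute constants $\varepsilon_0>0$ and $C>0$ such that, for every $V$ as above and every $0<\varepsilon<\varepsilon_0$ with $\|V\|_*<\varepsilon^9$, there are $k_1>0$ and $\lambda_1>0$,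 depending only on $V$ and $\varepsilon$, with the following property. Let $|v_q|>\varepsilon^{10}$, $|\sigma||A|^2<\varepsilon^{11}$, $k>k_1$, and fix a sign $\pm$. On the $k^{-1}\varepsilon^7$-neighborhood of $\chi_q(k,\varepsilon)$ the limit $W$, the eigenvalue $\lambda(t)$ and the function $u$ exist and are unique, and $u$, $\lambda(t)$ solve the equation with the quasiperiodic conditions. For every $\lambda_0>\lambda_1$, the curve $\lambda(t)=\lambda_0$ in this neighborhood lies in the $C\varepsilon^{11}\lambda_0^{-1/2}$-neighborhood of the curve $\hat\lambda^{\pm}(t)=\lambda_0$ (same sign, same index $j$), the latter taken in the $2k^{-1}\varepsilon^7$-neighborhood of $\chi_q(k,\varepsilon)$. -/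

import Mathlib

open Filter Topology
open scoped ENNReal ComplexConjugate

noncomputable section

namespace GrossPitaevskii

/-- The Euclidean plane: positions `x` and quasimomenta `t`. -/
abbrev Plane := EuclideanSpace ℝ (Fin 2)

/-- The lattice `ℤ²` of frequencies of functions that are `2π`-periodic in both variables. -/
abbrev Lattice := Fin 2 → ℤ

/-- A lattice vector as a point of the plane. -/
def latticePoint (n : Lattice) : Plane := WithLp.toLp 2 fun i => (n i : ℝ)

/-- The shifted lattice point `P_j(t) = j + t`; its squared length `p_j²(t) = |P_j(t)|²` is the
eigenvalue of `-Δ` on the plane wave `exp (i ⟨P_j(t), x⟩)`. -/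
def momentum (j : Lattice) (t : Plane) : Plane := latticePoint j + t

/-- The plane wave `x ↦ exp (i ⟨k, x⟩)`. -/
def planeWave (k x : Plane) : ℂ := Complex.exp (Complex.I * (inner ℝ k x : ℝ))

/-- The elementary cell `K = [0,1)²` of quasimomenta. -/
def cell : Set Plane := {t | ∀ i, t i ∈ Set.Ico (0 : ℝ) 1}

/-! ### Periodic potentials -/

/-- The trigonometric polynomial `∑ v_n exp (i ⟨n, x⟩)`. -/
def trigPoly (v : Lattice →₀ ℂ) (x : Plane) : ℂ :=
  ∑ n ∈ v.support, v n * planeWave (latticePoint n) x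

/-- `W` is `2π`-periodic in each variable. -/
def IsPeriodic (W : Plane → ℂ) : Prop :=
  ∀ (x : Plane) (i : Fin 2), W (x + EuclideanSpace.single i (2 * Real.pi)) = W x

/-- The `n`-th Fourier coefficient `(2π)⁻² ∫_Q W(x) exp (-i ⟨n, x⟩) dx`, `Q = [0,2π]²`. -/
def cellFourierCoeff (W : Plane → ℂ) (n : Lattice) : ℂ :=
  (1 / (2 * Real.pi) ^ 2 : ℝ) *
    ∫ x₁ in (0 : ℝ)..(2 * Real.pi), ∫ x₂ in (0 : ℝ)..(2 * Real.pi),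
      W !₂[x₁, x₂] * planeWave (-latticePoint n) !₂[x₁, x₂]

/-- The norm `‖W‖_* = ∑ |w_n|` of a periodic function, with values in `[0, ∞]`. -/
def starNorm (W : Plane → ℂ) : ℝ≥0∞ := ∑' n : Lattice, ‖cellFourierCoeff W n‖ₑ

/-! ### The resonant set -/

/-- The part `S_q(k, ε)` of the circle of radius `k` on which the von Laue condition
`|x| = |x - q|` is almost satisfied. -/
def resonantLayer (q : Lattice) (k ε : ℝ) : Set Plane :=
  {x | ‖x‖ = k ∧ |‖x‖ ^ 2 - ‖x - latticePoint q‖ ^ 2| < ε}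

/-- `t` is a point of the resonant set `χ_q(k, ε)`, and `j` is the index with `|P_j(t)| = k`:
`P_j(t)` lies in the resonant layer, `j` is the only index with `|P_j(t)| = k`, and the two
close values `p_j²(t)`, `p_{j-q}²(t)` are far from all the others. -/
structure IsResonant (q : Lattice) (k ε : ℝ) (j : Lattice) (t : Plane) : Prop where
  mem_cell : t ∈ cell
  mem_layer : momentum j t ∈ resonantLayer q k ε
  unique : ∀ i : Lattice, ‖momentum i t‖ = k → i = j
  separated : ∀ m : Lattice, m ≠ j → m ≠ j - q →
    2 * ε ^ 6 < |‖momentum j t‖ ^ 2 - ‖momentum m t‖ ^ 2| ∧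
    2 * ε ^ 6 < |‖momentum (j - q) t‖ ^ 2 - ‖momentum m t‖ ^ 2|

/-- `t` is in the `ρ`-neighbourhood of the resonant set, near a point with index `j`.
Quasimomenta matter modulo `ℤ²` only (replacing `(t, j)` by `(t + n, j - n)` does not change
`P_j(t)`), so that `t` itself is not confined to the cell. -/
def NearResonant (q : Lattice) (k ε ρ : ℝ) (j : Lattice) (t : Plane) : Prop :=
  ∃ t₀, IsResonant q k ε j t₀ ∧ dist t t₀ < ρ

/-! ### The two-level model -/

/-- The eigenvalue `a ± b` of the Hermitian matrix `[[p_j²(t), v_q], [conj v_q, p_{j-q}²(t)]]`: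
`2a = p_j² + p_{j-q}²` and `2b = (4 |v_q|² + (p_j² - p_{j-q}²)²)^{1/2}`. -/
def modelEigenvalue (s : ℤˣ) (v : Lattice →₀ ℂ) (q j : Lattice) (t : Plane) : ℝ :=
  (‖momentum j t‖ ^ 2 + ‖momentum (j - q) t‖ ^ 2) / 2 +
    ((s : ℤ) : ℝ) *
      (√(4 * ‖v q‖ ^ 2 + (‖momentum j t‖ ^ 2 - ‖momentum (j - q) t‖ ^ 2) ^ 2) / 2)

/-! ### Linear Bloch operators and their spectral projections -/

/-- `f` satisfies `(H₀(t) + W) f = μ f`, in the basis of the plane waves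
`exp (i ⟨P_m(t), x⟩)`: the operator `H₀(t) + W` has there the matrix
`|P_m(t)|² δ_{mp} + w_{m-p}`. -/
def EigenEquation (W : Plane → ℂ) (t : Plane) (μ : ℝ) (f : lp (fun _ : Lattice => ℂ) 2) : Prop :=
  ∀ m : Lattice,
    ((‖momentum m t‖ ^ 2 : ℝ) : ℂ) * f m + ∑' p : Lattice, cellFourierCoeff W (m - p) * f p = μ * f m

/-- `μ` is an eigenvalue of `H₀(t) + W`. -/
def IsEigenvalue (W : Plane → ℂ) (t : Plane) (μ : ℝ) : Prop :=
  ∃ f, f ≠ 0 ∧ EigenEquation W t μ f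

/-- The spectral subspace of `H₀(t) + W` for the disk of radius `r` about `c`. -/
def spectralSubspace (W : Plane → ℂ) (t : Plane) (c r : ℝ) :
    Submodule ℂ (lp (fun _ : Lattice => ℂ) 2) :=
  (Submodule.span ℂ {f | ∃ μ : ℝ, |μ - c| < r ∧ EigenEquation W t μ f}).topologicalClosure

instance spectralSubspace_hasOrthogonalProjection (W : Plane → ℂ) (t : Plane) (c r : ℝ) :
    (spectralSubspace W t c r).HasOrthogonalProjection :=
  haveI : CompleteSpace (spectralSubspace W t c r) := by
    unfold spectralSubspace
    infer_instance
  inferInstance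

/-- The matrix element `E_{mp}` of the spectral projection `E` of `H₀(t) + W` for the disk of
radius `r` about `c`. -/
def spectralProjection (W : Plane → ℂ) (t : Plane) (c r : ℝ) (m p : Lattice) : ℂ :=
  (spectralSubspace W t c r).starProjection (lp.single 2 p (1 : ℂ)) m

/-! ### Successive approximations -/

/-- The function `u_W = A ∑_m (E_W)_{mj} exp (i ⟨P_m(t), x⟩)`, where `E_W` is the spectral
projection of `H₀(t) + W` for the disk of radius `ε¹⁰/4` about the model eigenvalue. -/
def resonantWave (v : Lattice →₀ ℂ) (A : ℂ) (q : Lattice) (ε : ℝ) (s : ℤˣ) (j : Lattice)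
    (t : Plane) (W : Plane → ℂ) (x : Plane) : ℂ :=
  A * ∑' m : Lattice,
    spectralProjection W t (modelEigenvalue s v q j t) (ε ^ 10 / 4) m j *
      planeWave (momentum m t) x

/-- The potentials `W₀ = V` and `W_{m+1} = V + σ |u_{W_m}|²`. -/
def potentialSeq (v : Lattice →₀ ℂ) (σ : ℝ) (A : ℂ) (q : Lattice) (ε : ℝ) (s : ℤˣ) (j : Lattice)
    (t : Plane) : ℕ → Plane → ℂ
  | 0 => trigPoly v
  | m + 1 => fun x =>
      trigPoly v x +
        (σ * ‖resonantWave v A q ε s j t (potentialSeq v σ A q ε s j t m) x‖ ^ 2 : ℝ)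

/-- `u` and `lam` are the resonant wave and the eigenvalue that belong to the limit `W` of the
successive approximations: `W_m → W` in the norm `‖·‖_*`, `lam` is the eigenvalue of `H₀(t) + W`
in the disk about the model eigenvalue, and `u = u_W`. -/
def IsResonantState (v : Lattice →₀ ℂ) (σ : ℝ) (A : ℂ) (q : Lattice) (ε : ℝ) (s : ℤˣ)
    (j : Lattice) (t : Plane) (u : Plane → ℂ) (lam : ℝ) : Prop :=
  ∃ W : Plane → ℂ, Continuous W ∧ IsPeriodic W ∧
    Tendsto (fun m => starNorm (potentialSeq v σ A q ε s j t m - W)) atTop (𝓝 0) ∧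
    |lam - modelEigenvalue s v q j t| < ε ^ 10 / 4 ∧ IsEigenvalue W t lam ∧
    u = resonantWave v A q ε s j t W

/-- `u` is a classical solution of `-Δu + V u + σ |u|² u = lam u` in the plane with the
quasiperiodic conditions for `u` and its first derivatives. -/
structure SolvesGPE (v : Lattice →₀ ℂ) (σ : ℝ) (t : Plane) (u : Plane → ℂ) (lam : ℝ) : Prop where
  contDiff : ContDiff ℝ 2 u
  equation : ∀ x, -(Laplacian.laplacian u x) + trigPoly v x * u x + (σ * ‖u x‖ ^ 2 : ℝ) * u x =
    lam * u x
  quasiperiodic : ∀ (x : Plane) (i : Fin 2),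
    u (x + EuclideanSpace.single i (2 * Real.pi)) =
      Complex.exp (2 * Real.pi * Complex.I * (t i : ℝ)) * u x
  quasiperiodic_deriv : ∀ (x : Plane) (i : Fin 2),
    fderiv ℝ u (x + EuclideanSpace.single i (2 * Real.pi)) (EuclideanSpace.single i 1) =
      Complex.exp (2 * Real.pi * Complex.I * (t i : ℝ)) *
        fderiv ℝ u x (EuclideanSpace.single i 1)

/-- The curve `λ(t) = lam₀` of the resonant solutions for the parameter `k` and the index `j`:
the quasimomenta `t` in the `k⁻¹ε⁷`-neighbourhood of `χ_q(k, ε)` with `λ(t) = lam₀`. -/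
def isoenergeticCurve (v : Lattice →₀ ℂ) (σ : ℝ) (A : ℂ) (q : Lattice) (ε k : ℝ) (s : ℤˣ)
    (j : Lattice) (lam₀ : ℝ) : Set Plane :=
  {t | NearResonant q k ε (k⁻¹ * ε ^ 7) j t ∧ ∃ u, IsResonantState v σ A q ε s j t u lam₀}

/-- The model curve `λ^±(t) = lam₀` for the parameter `k` and the index `j`, on the
`2k⁻¹ε⁷`-neighbourhood of `χ_q(k, ε)`. -/
def modelCurve (v : Lattice →₀ ℂ) (q : Lattice) (ε k : ℝ) (s : ℤˣ) (j : Lattice)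
    (lam₀ : ℝ) : Set Plane :=
  {t | NearResonant q k ε (2 * k⁻¹ * ε ^ 7) j t ∧ modelEigenvalue s v q j t = lam₀}

end GrossPitaevskii

end

noncomputable section

namespace GrossPitaevskii

set_option linter.unusedSectionVars false


/-! In the basis of plane waves, `H₀(t) + W` is the diagonal `|P_m(t)|²` plus convolution with the
Fourier coefficients of `W`. Near the resonant set the model eigenvalue stays at distance at least
`ε⁶` from every level other than `j` and `j - q`, while `‖V‖_* < ε⁹`. So the operator is nearly the
`2 × 2` block of these two levels, and the eigenvalues of the block are at least `2ε¹⁰` apart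
because `|v_q| > ε¹⁰`.

Linear problem. For `W` within `300ε¹¹` of `V`, an eigenvector with component one along the model
eigenvector is described by the shift of its eigenvalue, its component along the other model
eigenvector, and its tail at the remaining frequencies. In suitably scaled coordinates these are the
fixed point of a contraction `step` of the unit ball (`norm_step_le`, `norm_step_sub_le`). The
argument is run in `ℓᵖ` for general `p`. The case `p = 1` gives bounds in `‖·‖_*` and absolutely
convergent series; the case `p = 2` gives uniqueness among all eigenvectors. Hence the disk contains
exactly one eigenvalue, it is real and simple, and the spectral projection has rank one
(`exists_eigenpair`, `Eigenpair.unique`, `Eigenpair.spectralProjection_eq`).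

Self-consistency. Column `j` of the projection depends on `W` with a Lipschitz constant of order
`ε⁻¹⁰`, the inverse of the gap. As `|σ||A|² < ε¹¹`, the map `W ↦ V + σ|u_W|²` is a contraction
(`norm_next_sub_le`). At its fixed point `u_W` is an eigenvector, or zero, for a potential which is
itself `V + σ|u_W|²`, and that is the nonlinear equation (`solvesGPE_of_isEigen`).

Curves. The model accounts for the two resonant levels exactly, so the eigenvalue differs from the
model one by `O(ε¹¹)` only (`Eigenpair.near_model`). Moving `t` orthogonally to `q` changes both
resonant levels by the same quadratic polynomial, with slope at least `k|q|`. A displacement of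
length `O(ε¹¹/k)` therefore reaches the model curve (`exists_mem_modelCurve`), and `√λ₀ ≤ 4k` turns
`1/k` into `λ₀^(-1/2)`. -/

/-- The sequence space `ℓᵖ(ℤ²)`. -/
abbrev Seq (p : ℝ≥0∞) := lp (fun _ : Lattice => ℂ) p

/-! ### Convolution of `ℓ¹` with `ℓᵖ`. -/

section Sequences

variable {p : ℝ≥0∞}

theorem memℓp_shift (n : Lattice) {f : Lattice → ℂ} (hf : Memℓp f p) :
    Memℓp (fun m => f (m - n)) p := by
  rcases p.trichotomy with rfl | rfl | hp
  · rw [memℓp_zero_iff] at hf ⊢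
    exact hf.preimage (sub_left_injective.injOn)
  · rw [memℓp_infty_iff] at hf ⊢
    refine hf.mono ?_
    rintro _ ⟨m, rfl⟩
    exact ⟨m - n, rfl⟩
  · rw [memℓp_gen_iff hp] at hf ⊢
    exact ((Equiv.subRight n).summable_iff (f := fun m => ‖f m‖ ^ p.toReal)).2 hf

theorem norm_shift_le [hp1 : Fact (1 ≤ p)] (n : Lattice) (f : Seq p) :
    ‖(⟨fun m => f (m - n), memℓp_shift n (lp.memℓp f)⟩ : Seq p)‖ ≤ 1 * ‖f‖ := by
  rw [one_mul]
  rcases p.trichotomy with rfl | rfl | hp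
  · exact absurd hp1.out (by simp)
  · exact lp.norm_le_of_forall_le (norm_nonneg _) fun m =>
      lp.norm_apply_le_norm (by simp) f (m - n)
  · rw [lp.norm_eq_tsum_rpow hp, lp.norm_eq_tsum_rpow hp]
    exact le_of_eq (congrArg (· ^ (1 / p.toReal))
      ((Equiv.subRight n).tsum_eq (fun m => ‖f m‖ ^ p.toReal)))

/-- Translation of the frequencies by `n`. -/
def shift [Fact (1 ≤ p)] (n : Lattice) : Seq p →L[ℂ] Seq p :=
  LinearMap.mkContinuous
    { toFun := fun f => ⟨fun m => f (m - n), memℓp_shift n (lp.memℓp f)⟩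
      map_add' := fun _ _ => rfl
      map_smul' := fun _ _ => rfl } 1 (norm_shift_le n)

@[simp] theorem shift_apply [Fact (1 ≤ p)] (n : Lattice) (f : Seq p) (m : Lattice) :
    shift n f m = f (m - n) := rfl

theorem norm_shift_apply_le [Fact (1 ≤ p)] (n : Lattice) (f : Seq p) : ‖shift n f‖ ≤ ‖f‖ :=
  (norm_shift_le n f).trans_eq (one_mul _)

theorem norm_apply_le [hp : Fact (1 ≤ p)] (f : Seq p) (m : Lattice) : ‖f m‖ ≤ ‖f‖ :=
  lp.norm_apply_le_norm (zero_lt_one.trans_le hp.out).ne' f m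

/-- A sequence dominated by `C` times an element of `ℓᵖ` belongs to `ℓᵖ`. -/
theorem memℓp_of_norm_le {f : Lattice → ℂ} {C : ℝ} {g : Seq p} (h : ∀ m, ‖f m‖ ≤ C * ‖g m‖) :
    Memℓp f p := by
  refine Memℓp.mono (g := fun m => C * ‖g m‖) ?_ h
  exact (memℓp_norm_iff.2 (lp.memℓp g)).const_mul C

theorem norm_le_of_norm_le [hp : Fact (1 ≤ p)] {f g : Seq p} {C : ℝ} (hC : 0 ≤ C)
    (h : ∀ m, ‖f m‖ ≤ C * ‖g m‖) : ‖f‖ ≤ C * ‖g‖ := by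
  have h1 : ‖f‖ ≤ ‖(C : ℂ) • g‖ := by
    refine lp.norm_mono (zero_lt_one.trans_le hp.out).ne' fun m => ?_
    rw [lp.coeFn_smul, Pi.smul_apply, norm_smul]
    simpa [abs_of_nonneg hC] using h m
  exact h1.trans_eq (by rw [norm_smul, Complex.norm_real, Real.norm_of_nonneg hC])

theorem summable_norm (w : Seq 1) : Summable fun n => ‖w n‖ := by
  simpa using (lp.memℓp w).summable (by simp)

theorem norm_eq_tsum (w : Seq 1) : ‖w‖ = ∑' n, ‖w n‖ := by
  simpa using lp.norm_eq_tsum_rpow (p := 1) (by simp) w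

theorem memℓp_one {w : Lattice → ℂ} (h : Summable fun n => ‖w n‖) : Memℓp w 1 :=
  memℓp_gen (by simpa using h)

/-- The convolution of `w ∈ ℓ¹` with `f ∈ ℓᵖ`. -/
def conv [Fact (1 ≤ p)] (w : Seq 1) (f : Seq p) : Seq p := ∑' n, w n • shift n f

theorem summable_norm_conv [Fact (1 ≤ p)] (w : Seq 1) (f : Seq p) :
    Summable fun n => ‖w n • shift n f‖ := by
  refine Summable.of_nonneg_of_le (fun _ => norm_nonneg _) (fun n => ?_)
    ((summable_norm w).mul_right ‖f‖)
  rw [norm_smul]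
  exact mul_le_mul_of_nonneg_left (norm_shift_apply_le n f) (norm_nonneg _)

/-- Young's inequality. Translations do not increase the norm, so the series of translates that
defines `conv` converges absolutely, for every `p` at once. -/
theorem norm_conv_le [Fact (1 ≤ p)] (w : Seq 1) (f : Seq p) : ‖conv w f‖ ≤ ‖w‖ * ‖f‖ := by
  refine (norm_tsum_le_tsum_norm (summable_norm_conv w f)).trans ?_
  rw [norm_eq_tsum w, ← tsum_mul_right]
  refine (summable_norm_conv w f).tsum_le_tsum (fun n => ?_) ((summable_norm w).mul_right ‖f‖)
  rw [norm_smul]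
  exact mul_le_mul_of_nonneg_left (norm_shift_apply_le n f) (norm_nonneg _)

theorem conv_apply [Fact (1 ≤ p)] (w : Seq 1) (f : Seq p) (m : Lattice) :
    conv w f m = ∑' n, w (m - n) * f n := by
  have h := (lp.evalCLM ℂ (fun _ : Lattice => ℂ) p m).map_tsum (summable_norm_conv w f).of_norm
  have h' : conv w f m = ∑' n, w n * f (m - n) := h
  rw [h', ← (Equiv.subLeft m).tsum_eq]
  simp

theorem conv_add_right [Fact (1 ≤ p)] (w : Seq 1) (f g : Seq p) :
    conv w (f + g) = conv w f + conv w g := by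
  unfold conv
  rw [← (summable_norm_conv w f).of_norm.tsum_add (summable_norm_conv w g).of_norm]
  simp

theorem conv_smul_right [Fact (1 ≤ p)] (w : Seq 1) (c : ℂ) (f : Seq p) :
    conv w (c • f) = c • conv w f := by
  unfold conv
  rw [← (summable_norm_conv w f).of_norm.tsum_const_smul]
  simp [smul_comm c]

theorem conv_sub_right [Fact (1 ≤ p)] (w : Seq 1) (f g : Seq p) :
    conv w (f - g) = conv w f - conv w g := by
  unfold conv
  rw [← (summable_norm_conv w f).of_norm.tsum_sub (summable_norm_conv w g).of_norm]
  simp [smul_sub]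

theorem conv_sub_left [Fact (1 ≤ p)] (w w' : Seq 1) (f : Seq p) :
    conv (w - w') f = conv w f - conv w' f := by
  unfold conv
  rw [← (summable_norm_conv w f).of_norm.tsum_sub (summable_norm_conv w' f).of_norm]
  simp [sub_smul]

/-- Convolution with a sequence supported at one frequency. -/
theorem conv_single [Fact (1 ≤ p)] (w : Seq 1) (j : Lattice) (a : ℂ) (m : Lattice) :
    conv w (lp.single p j a) m = w (m - j) * a := by
  rw [conv_apply, tsum_eq_single j]
  · simp
  · intro n hn
    simp [hn]

end Sequences

/-! ### The abstract two-level problem and its coordinates. -/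

/-- Two levels `d j`, `d (j - q)`, coupled by `v q`, that are well separated from all others:
`(α, β)` is a unit eigenvector of the `2 × 2` matrix for the eigenvalue `lam`, and `lam'` is the
other eigenvalue. -/
structure TwoLevel (e : ℝ) (d : Lattice → ℝ) (v : Seq 1) (j q : Lattice) (lam lam' : ℝ)
    (α β : ℂ) : Prop where
  pos : 0 < e
  small : e < 1 / 10 ^ 9
  ne_zero : q ≠ 0
  coeff_zero : v 0 = 0
  coeff_neg : v (-q) = conj (v q)
  norm_le : ‖v‖ ≤ e ^ 9
  unit : ‖α‖ ^ 2 + ‖β‖ ^ 2 = 1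
  eigen_fst : (d j : ℂ) * α + v q * β = lam * α
  eigen_snd : conj (v q) * α + (d (j - q) : ℂ) * β = lam * β
  trace : lam + lam' = d j + d (j - q)
  gap : 2 * e ^ 10 ≤ |lam' - lam|
  separated : ∀ m, m ≠ j → m ≠ j - q → e ^ 6 ≤ |d m - lam|

namespace TwoLevel

variable {e : ℝ} {d : Lattice → ℝ} {v : Seq 1} {j q : Lattice} {lam lam' : ℝ} {α β : ℂ}
  {p : ℝ≥0∞}

theorem norm_alpha_le (H : TwoLevel e d v j q lam lam' α β) : ‖α‖ ≤ 1 := by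
  have := H.unit
  nlinarith [norm_nonneg α, norm_nonneg β]

theorem norm_beta_le (H : TwoLevel e d v j q lam lam' α β) : ‖β‖ ≤ 1 := by
  have := H.unit
  nlinarith [norm_nonneg α, norm_nonneg β]

theorem unit_complex (H : TwoLevel e d v j q lam lam' α β) :
    conj α * α + conj β * β = 1 := by
  rw [Complex.conj_mul', Complex.conj_mul']
  exact_mod_cast H.unit

/-- The model eigenvector for `lam`. -/
def plusVec (_ : TwoLevel e d v j q lam lam' α β) (p : ℝ≥0∞) : Seq p :=
  lp.single p j α + lp.single p (j - q) β

/-- The model eigenvector for `lam'`. -/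
def minusVec (_ : TwoLevel e d v j q lam lam' α β) (p : ℝ≥0∞) : Seq p :=
  lp.single p j (-conj β) + lp.single p (j - q) (conj α)

/-- The component of `f` along the model eigenvector for `lam`. -/
def plusCoord (_ : TwoLevel e d v j q lam lam' α β) (f : Seq p) : ℂ :=
  conj α * f j + conj β * f (j - q)

/-- The component of `f` along the model eigenvector for `lam'`. -/
def minusCoord (_ : TwoLevel e d v j q lam lam' α β) (f : Seq p) : ℂ :=
  -β * f j + α * f (j - q)

theorem plusCoord_sub (H : TwoLevel e d v j q lam lam' α β) (f g : Seq p) :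
    H.plusCoord (f - g) = H.plusCoord f - H.plusCoord g := by
  simp only [plusCoord, lp.coeFn_sub, Pi.sub_apply]; ring

theorem minusCoord_sub (H : TwoLevel e d v j q lam lam' α β) (f g : Seq p) :
    H.minusCoord (f - g) = H.minusCoord f - H.minusCoord g := by
  simp only [minusCoord, lp.coeFn_sub, Pi.sub_apply]; ring

/-- The reduced resolvent of the diagonal part, cut off near its poles. -/
def multiplier (_ : TwoLevel e d v j q lam lam' α β) (z : ℂ) (m : Lattice) : ℂ :=
  if m = j ∨ m = j - q ∨ ‖(d m : ℂ) - z‖ < e ^ 6 / 2 then 0 else ((d m : ℂ) - z)⁻¹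

/-- The cut-off in `multiplier` makes this bound hold for all `z`. In the disk about `lam` the
cut-off removes only the two resonant frequencies, by `le_norm_sub`. -/
theorem norm_multiplier_le (H : TwoLevel e d v j q lam lam' α β) (z : ℂ) (m : Lattice) :
    ‖H.multiplier z m‖ ≤ 2 / e ^ 6 := by
  have he := H.pos
  unfold multiplier
  split_ifs with h
  · simp; positivity
  · push Not at h
    rw [norm_inv, inv_le_comm₀ ((by positivity : 0 < e ^ 6 / 2).trans_le h.2.2) (by positivity)]
    simpa using h.2.2

/-- The reduced resolvent of the diagonal part on `ℓᵖ`. -/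
def applyMul (H : TwoLevel e d v j q lam lam' α β) (z : ℂ) (f : Seq p) : Seq p :=
  ⟨fun m => H.multiplier z m * f m, memℓp_of_norm_le (C := 2 / e ^ 6) (g := f) fun m => by
    rw [norm_mul]
    exact mul_le_mul_of_nonneg_right (H.norm_multiplier_le z m) (norm_nonneg _)⟩

theorem applyMul_apply (H : TwoLevel e d v j q lam lam' α β) (z : ℂ) (f : Seq p) (m : Lattice) :
    H.applyMul z f m = H.multiplier z m * f m := rfl

variable [hp1 : Fact (1 ≤ p)]

theorem norm_single_le (i : Lattice) {a : ℂ} (ha : ‖a‖ ≤ 1) : ‖(lp.single p i a : Seq p)‖ ≤ 1 :=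
  (lp.norm_single (E := fun _ : Lattice => ℂ) (zero_lt_one.trans_le hp1.out) i a).trans_le ha

theorem norm_plusVec_le (H : TwoLevel e d v j q lam lam' α β) : ‖H.plusVec p‖ ≤ 2 :=
  (norm_add_le_of_le (norm_single_le j H.norm_alpha_le)
    (norm_single_le (j - q) H.norm_beta_le)).trans_eq one_add_one_eq_two

theorem norm_minusVec_le (H : TwoLevel e d v j q lam lam' α β) : ‖H.minusVec p‖ ≤ 2 :=
  (norm_add_le_of_le (norm_single_le j (by simpa using H.norm_beta_le))
    (norm_single_le (j - q) (by simpa using H.norm_alpha_le))).trans_eq one_add_one_eq_two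

theorem norm_plusCoord_le (H : TwoLevel e d v j q lam lam' α β) (f : Seq p) :
    ‖H.plusCoord f‖ ≤ 2 * ‖f‖ := by
  have h1 := norm_apply_le f j
  have h2 := norm_apply_le f (j - q)
  have h3 := H.norm_alpha_le
  have h4 := H.norm_beta_le
  refine (norm_add_le _ _).trans ?_
  rw [norm_mul, norm_mul, RCLike.norm_conj, RCLike.norm_conj]
  nlinarith [norm_nonneg (f j), norm_nonneg (f (j - q)), norm_nonneg α, norm_nonneg β]

theorem norm_minusCoord_le (H : TwoLevel e d v j q lam lam' α β) (f : Seq p) :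
    ‖H.minusCoord f‖ ≤ 2 * ‖f‖ := by
  have h1 := norm_apply_le f j
  have h2 := norm_apply_le f (j - q)
  have h3 := H.norm_alpha_le
  have h4 := H.norm_beta_le
  refine (norm_add_le _ _).trans ?_
  rw [norm_mul, norm_mul, norm_neg]
  nlinarith [norm_nonneg (f j), norm_nonneg (f (j - q)), norm_nonneg α, norm_nonneg β]

theorem norm_applyMul_le (H : TwoLevel e d v j q lam lam' α β) (z : ℂ) (f : Seq p) :
    ‖H.applyMul z f‖ ≤ 2 / e ^ 6 * ‖f‖ := by
  have he := H.pos
  refine norm_le_of_norm_le (by positivity) fun m => ?_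
  rw [applyMul_apply, norm_mul]
  exact mul_le_mul_of_nonneg_right (H.norm_multiplier_le z m) (norm_nonneg _)

theorem le_norm_sub (H : TwoLevel e d v j q lam lam' α β) {z : ℂ}
    (hz : ‖z - lam‖ ≤ e ^ 10 / 4) {m : Lattice} (hm : m ≠ j) (hm' : m ≠ j - q) :
    e ^ 6 / 2 ≤ ‖(d m : ℂ) - z‖ := by
  have h1 := H.separated m hm hm'
  have he := H.pos
  have hs := H.small
  have h2 : ‖(d m : ℂ) - lam‖ = |d m - lam| := by
    rw [← Complex.ofReal_sub, Complex.norm_real, Real.norm_eq_abs]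
  have h3 : ‖(d m : ℂ) - lam‖ ≤ ‖(d m : ℂ) - z‖ + ‖z - lam‖ := norm_sub_le_norm_sub_add_norm_sub _ _ _
  have h4 : e ^ 10 ≤ e ^ 6 := pow_le_pow_of_le_one he.le (by linarith) (by norm_num)
  linarith [pow_pos he 6]

theorem multiplier_eq (H : TwoLevel e d v j q lam lam' α β) {z : ℂ}
    (hz : ‖z - lam‖ ≤ e ^ 10 / 4) {m : Lattice} (hm : m ≠ j) (hm' : m ≠ j - q) :
    H.multiplier z m = ((d m : ℂ) - z)⁻¹ := by
  unfold multiplier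
  rw [if_neg]
  push Not
  exact ⟨hm, hm', H.le_norm_sub hz hm hm'⟩

/-- Resolvent identity: the difference of two inverses is their product times `z - z'`. -/
theorem norm_multiplier_sub_le (H : TwoLevel e d v j q lam lam' α β) {z z' : ℂ}
    (hz : ‖z - lam‖ ≤ e ^ 10 / 4) (hz' : ‖z' - lam‖ ≤ e ^ 10 / 4) (m : Lattice) :
    ‖H.multiplier z m - H.multiplier z' m‖ ≤ 4 / e ^ 12 * ‖z - z'‖ := by
  have he := H.pos
  by_cases hm : m = j
  · simp [multiplier, hm]; positivity
  by_cases hm' : m = j - q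
  · simp [multiplier, hm']; positivity
  have h1 := H.norm_multiplier_le z m
  have h2 := H.norm_multiplier_le z' m
  have h3 : (d m : ℂ) - z ≠ 0 := norm_pos_iff.1
    ((by positivity : 0 < e ^ 6 / 2).trans_le (H.le_norm_sub hz hm hm'))
  have h4 : (d m : ℂ) - z' ≠ 0 := norm_pos_iff.1
    ((by positivity : 0 < e ^ 6 / 2).trans_le (H.le_norm_sub hz' hm hm'))
  have h5 : H.multiplier z m - H.multiplier z' m =
      H.multiplier z m * H.multiplier z' m * (z - z') := by
    rw [H.multiplier_eq hz hm hm', H.multiplier_eq hz' hm hm']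
    field_simp
    ring
  rw [h5, norm_mul, norm_mul]
  refine mul_le_mul_of_nonneg_right ?_ (norm_nonneg _)
  refine (mul_le_mul h1 h2 (norm_nonneg _) (by positivity)).trans_eq ?_
  field_simp
  norm_num

theorem norm_applyMul_sub_le (H : TwoLevel e d v j q lam lam' α β) {z z' : ℂ}
    (hz : ‖z - lam‖ ≤ e ^ 10 / 4) (hz' : ‖z' - lam‖ ≤ e ^ 10 / 4) (f g : Seq p) :
    ‖H.applyMul z f - H.applyMul z' g‖ ≤
      2 / e ^ 6 * ‖f - g‖ + 4 / e ^ 12 * ‖z - z'‖ * ‖g‖ := by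
  have he := H.pos
  have h1 : H.applyMul z f - H.applyMul z' g =
      H.applyMul z (f - g) + (H.applyMul z g - H.applyMul z' g) := by
    ext m
    simp only [lp.coeFn_sub, lp.coeFn_add, Pi.sub_apply, Pi.add_apply, applyMul_apply]
    ring
  rw [h1]
  refine norm_add_le_of_le (H.norm_applyMul_le z _) (norm_le_of_norm_le (by positivity) fun m => ?_)
  simp only [lp.coeFn_sub, Pi.sub_apply, applyMul_apply]
  rw [← sub_mul, norm_mul]
  exact mul_le_mul_of_nonneg_right (H.norm_multiplier_sub_le hz hz' m) (norm_nonneg _)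

/-! ### The fixed point map -/

/-- The two-level part of the vector with coordinates `ξ`. -/
def head (H : TwoLevel e d v j q lam lam' α β) (ξ : ℂ × ℂ × Seq p) : Seq p :=
  H.plusVec p + ξ.2.1 • H.minusVec p

/-- The vector with coordinates `ξ`. -/
def vec (H : TwoLevel e d v j q lam lam' α β) (ξ : ℂ × ℂ × Seq p) : Seq p :=
  -- The true tail has size at most `20e³` (potential `2e⁹`, vector `5`, inverse distance `2/e⁶`),
  -- so after division by `e²` it is still small. With this weight `v` applied to the tail is of
  -- order `e¹¹`, the same order as `w - v`.
  H.head ξ + ((e ^ 2 : ℝ) : ℂ) • ξ.2.2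

/-- The approximate eigenvalue with coordinates `ξ`. -/
def value (_ : TwoLevel e d v j q lam lam' α β) (ξ : ℂ × ℂ × Seq p) : ℂ :=
  lam + ((e ^ 10 / 4 : ℝ) : ℂ) * ξ.1

/-- The perturbation, applied to the vector with coordinates `ξ`. -/
def residual (H : TwoLevel e d v j q lam lam' α β) (w : Seq 1) (ξ : ℂ × ℂ × Seq p) : Seq p :=
  conv (w - v) (H.vec ξ) + ((e ^ 2 : ℝ) : ℂ) • conv v ξ.2.2

/-- The map whose fixed points are the normalized eigenvectors of the perturbed operator. -/
def step (H : TwoLevel e d v j q lam lam' α β) (w : Seq 1) (ξ : ℂ × ℂ × Seq p) :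
    ℂ × ℂ × Seq p :=
  -- The three entries solve the eigenvalue equation projected on the model eigenvector, on the
  -- other model eigenvector, and on the nonresonant frequencies. The factor `4/e¹⁰` scales the disk
  -- of admissible eigenvalues to the unit disk.
  (((4 / e ^ 10 : ℝ) : ℂ) * H.plusCoord (H.residual w ξ),
    H.minusCoord (H.residual w ξ) / (H.value ξ - lam'),
    ((-(1 / e ^ 2) : ℝ) : ℂ) • H.applyMul (H.value ξ) (conv w (H.vec ξ)))

theorem norm_real_smul {c : ℝ} (hc : 0 ≤ c) (f : Seq p) : ‖((c : ℝ) : ℂ) • f‖ = c * ‖f‖ := by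
  rw [norm_smul, Complex.norm_real, Real.norm_of_nonneg hc]

theorem norm_vec_le (H : TwoLevel e d v j q lam lam' α β) {ξ : ℂ × ℂ × Seq p} (hξ : ‖ξ‖ ≤ 1) :
    ‖H.vec ξ‖ ≤ 5 := by
  have he := H.pos
  have hs := H.small
  have h1 : ‖ξ.2.1‖ ≤ 1 := (norm_fst_le ξ.2).trans ((norm_snd_le ξ).trans hξ)
  have h2 : ‖ξ.2.2‖ ≤ 1 := (norm_snd_le ξ.2).trans ((norm_snd_le ξ).trans hξ)
  have h3 : e ^ 2 ≤ 1 := pow_le_one₀ he.le (by linarith)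
  have h4 : ‖ξ.2.1 • H.minusVec p‖ ≤ 1 * 2 := by
    rw [norm_smul]
    exact mul_le_mul h1 H.norm_minusVec_le (norm_nonneg _) zero_le_one
  have h5 : ‖((e ^ 2 : ℝ) : ℂ) • ξ.2.2‖ ≤ 1 * 1 := by
    rw [norm_real_smul (by positivity)]
    exact mul_le_mul h3 h2 (norm_nonneg _) zero_le_one
  have h6 := norm_add_le_of_le (norm_add_le_of_le (H.norm_plusVec_le (p := p)) h4) h5
  unfold vec head
  linarith

theorem norm_vec_sub_le (H : TwoLevel e d v j q lam lam' α β) (ξ ξ' : ℂ × ℂ × Seq p) :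
    ‖H.vec ξ - H.vec ξ'‖ ≤ 3 * ‖ξ - ξ'‖ := by
  have he := H.pos
  have hs := H.small
  have h1 : ‖ξ.2.1 - ξ'.2.1‖ ≤ ‖ξ - ξ'‖ := (norm_fst_le (ξ - ξ').2).trans (norm_snd_le (ξ - ξ'))
  have h2 : ‖ξ.2.2 - ξ'.2.2‖ ≤ ‖ξ - ξ'‖ := (norm_snd_le (ξ - ξ').2).trans (norm_snd_le (ξ - ξ'))
  have h3 : e ^ 2 ≤ 1 := pow_le_one₀ he.le (by linarith)
  have h4 : ‖(ξ.2.1 - ξ'.2.1) • H.minusVec p‖ ≤ ‖ξ - ξ'‖ * 2 := by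
    rw [norm_smul]
    exact mul_le_mul h1 H.norm_minusVec_le (norm_nonneg _) (norm_nonneg _)
  have h5 : ‖((e ^ 2 : ℝ) : ℂ) • (ξ.2.2 - ξ'.2.2)‖ ≤ 1 * ‖ξ - ξ'‖ := by
    rw [norm_real_smul (by positivity)]
    exact mul_le_mul h3 h2 (norm_nonneg _) zero_le_one
  have h6 : H.vec ξ - H.vec ξ' =
      (ξ.2.1 - ξ'.2.1) • H.minusVec p + ((e ^ 2 : ℝ) : ℂ) • (ξ.2.2 - ξ'.2.2) := by
    unfold vec head
    rw [sub_smul, smul_sub]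
    abel
  rw [h6]
  exact (norm_add_le_of_le h4 h5).trans_eq (by ring)

theorem norm_residual_le (H : TwoLevel e d v j q lam lam' α β) {w : Seq 1} {ξ : ℂ × ℂ × Seq p}
    (hw : ‖w - v‖ ≤ 300 * e ^ 11) (hξ : ‖ξ‖ ≤ 1) : ‖H.residual w ξ‖ ≤ 1501 * e ^ 11 := by
  have he := H.pos
  have h2 : ‖ξ.2.2‖ ≤ 1 := (norm_snd_le ξ.2).trans ((norm_snd_le ξ).trans hξ)
  have h3 : ‖conv (w - v) (H.vec ξ)‖ ≤ 300 * e ^ 11 * 5 :=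
    (norm_conv_le _ _).trans (mul_le_mul hw (H.norm_vec_le hξ) (norm_nonneg _) (by positivity))
  have h4 : ‖((e ^ 2 : ℝ) : ℂ) • conv v ξ.2.2‖ ≤ e ^ 2 * (e ^ 9 * 1) := by
    rw [norm_real_smul (by positivity)]
    exact mul_le_mul_of_nonneg_left ((norm_conv_le _ _).trans
      (mul_le_mul H.norm_le h2 (norm_nonneg _) (by positivity))) (by positivity)
  exact (norm_add_le_of_le h3 h4).trans_eq (by ring)

theorem norm_residual_sub_le (H : TwoLevel e d v j q lam lam' α β) {w w' : Seq 1}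
    {ξ ξ' : ℂ × ℂ × Seq p} (hw : ‖w - v‖ ≤ 300 * e ^ 11) (hξ : ‖ξ'‖ ≤ 1) :
    ‖H.residual w ξ - H.residual w' ξ'‖ ≤ 901 * e ^ 11 * ‖ξ - ξ'‖ + 5 * ‖w - w'‖ := by
  have he := H.pos
  have h2 : ‖ξ.2.2 - ξ'.2.2‖ ≤ ‖ξ - ξ'‖ := (norm_snd_le (ξ - ξ').2).trans (norm_snd_le (ξ - ξ'))
  have h3 : ‖conv (w - v) (H.vec ξ - H.vec ξ')‖ ≤ 300 * e ^ 11 * (3 * ‖ξ - ξ'‖) :=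
    (norm_conv_le _ _).trans
      (mul_le_mul hw (H.norm_vec_sub_le ξ ξ') (norm_nonneg _) (by positivity))
  have h4 : ‖((e ^ 2 : ℝ) : ℂ) • conv v (ξ.2.2 - ξ'.2.2)‖ ≤ e ^ 2 * (e ^ 9 * ‖ξ - ξ'‖) := by
    rw [norm_real_smul (by positivity)]
    exact mul_le_mul_of_nonneg_left ((norm_conv_le _ _).trans
      (mul_le_mul H.norm_le h2 (norm_nonneg _) (by positivity))) (by positivity)
  have h5 : ‖conv (w - w') (H.vec ξ')‖ ≤ ‖w - w'‖ * 5 :=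
    (norm_conv_le _ _).trans (mul_le_mul_of_nonneg_left (H.norm_vec_le hξ) (norm_nonneg _))
  have h6 : H.residual w ξ - H.residual w' ξ' = conv (w - v) (H.vec ξ - H.vec ξ') +
      ((e ^ 2 : ℝ) : ℂ) • conv v (ξ.2.2 - ξ'.2.2) + conv (w - w') (H.vec ξ') := by
    unfold residual
    simp only [conv_sub_left, conv_sub_right, smul_sub]
    abel
  rw [h6]
  exact (norm_add_le_of_le (norm_add_le_of_le h3 h4) h5).trans_eq (by ring)

theorem norm_value_sub_le (H : TwoLevel e d v j q lam lam' α β) {ξ : ℂ × ℂ × Seq p}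
    (hξ : ‖ξ‖ ≤ 1) : ‖H.value ξ - lam‖ ≤ e ^ 10 / 4 := by
  have he := H.pos
  have h1 : ‖ξ.1‖ ≤ 1 := (norm_fst_le ξ).trans hξ
  unfold value
  rw [add_sub_cancel_left, norm_mul, Complex.norm_real, Real.norm_of_nonneg (by positivity)]
  exact mul_le_of_le_one_right (by positivity) h1

theorem norm_value_sub_value_le (H : TwoLevel e d v j q lam lam' α β) (ξ ξ' : ℂ × ℂ × Seq p) :
    ‖H.value ξ - H.value ξ'‖ ≤ e ^ 10 / 4 * ‖ξ - ξ'‖ := by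
  have he := H.pos
  have h1 : ‖ξ.1 - ξ'.1‖ ≤ ‖ξ - ξ'‖ := norm_fst_le (ξ - ξ')
  unfold value
  rw [add_sub_add_left_eq_sub, ← mul_sub, norm_mul, Complex.norm_real,
    Real.norm_of_nonneg (by positivity)]
  exact mul_le_mul_of_nonneg_left h1 (by positivity)

theorem le_norm_value_sub (H : TwoLevel e d v j q lam lam' α β) {z : ℂ}
    (hz : ‖z - lam‖ ≤ e ^ 10 / 4) : e ^ 10 ≤ ‖z - lam'‖ := by
  have h1 := H.gap
  have h2 : ‖(lam' : ℂ) - lam‖ = |lam' - lam| := by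
    rw [← Complex.ofReal_sub, Complex.norm_real, Real.norm_eq_abs]
  have h3 : ‖(lam' : ℂ) - lam‖ ≤ ‖(lam' : ℂ) - z‖ + ‖z - lam‖ :=
    norm_sub_le_norm_sub_add_norm_sub _ _ _
  rw [norm_sub_rev (lam' : ℂ) z] at h3
  linarith [pow_pos H.pos 10]

theorem norm_div_sub_div_le {a a' D D' : ℂ} {c : ℝ} (hc : 0 < c) (hD : c ≤ ‖D‖) (hD' : c ≤ ‖D'‖) :
    ‖a / D - a' / D'‖ ≤ ‖a - a'‖ / c + ‖a'‖ * ‖D - D'‖ / c ^ 2 := by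
  have h1 : D ≠ 0 := norm_pos_iff.1 (hc.trans_le hD)
  have h2 : D' ≠ 0 := norm_pos_iff.1 (hc.trans_le hD')
  have h3 : a / D - a' / D' = (a - a') / D + a' * (D' - D) / (D * D') := by
    field_simp
    ring
  rw [h3]
  refine norm_add_le_of_le ?_ ?_
  · rw [norm_div]
    gcongr
  · rw [norm_div, norm_mul, norm_mul, norm_sub_rev D' D, sq]
    gcongr

theorem norm_perturbed_le (H : TwoLevel e d v j q lam lam' α β) {w : Seq 1}
    (hw : ‖w - v‖ ≤ 300 * e ^ 11) : ‖w‖ ≤ 2 * e ^ 9 := by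
  have he := H.pos
  have hs := H.small
  have h1 : ‖w‖ ≤ ‖v‖ + ‖w - v‖ := norm_le_insert' w v
  have h3 : e ^ 2 ≤ 1 / 1000 := by nlinarith
  have h4 : e ^ 11 ≤ e ^ 9 * (1 / 1000) :=
    (by ring : e ^ 11 = e ^ 9 * e ^ 2).trans_le (mul_le_mul_of_nonneg_left h3 (by positivity))
  linarith [H.norm_le, pow_pos he 9]

/-- Each entry carries a spare factor `e`: the residual is `O(e¹¹)` and is divided by the gap `e¹⁰`,
and the rescaled tail is `O(e)`. The bound `1/2` in place of `1` later puts the eigenvalue strictly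
inside the disk. -/
theorem norm_step_le (H : TwoLevel e d v j q lam lam' α β) {w : Seq 1} {ξ : ℂ × ℂ × Seq p}
    (hw : ‖w - v‖ ≤ 300 * e ^ 11) (hξ : ‖ξ‖ ≤ 1) : ‖H.step w ξ‖ ≤ 1 / 2 := by
  have he := H.pos
  have hs := H.small
  have hr := H.norm_residual_le hw hξ
  have hz := H.norm_value_sub_le hξ
  have h10 := H.le_norm_value_sub hz
  refine norm_prod_le_iff.2 ⟨?_, norm_prod_le_iff.2 ⟨?_, ?_⟩⟩
  · simp only [step]
    rw [norm_mul, Complex.norm_real, Real.norm_of_nonneg (by positivity)]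
    calc 4 / e ^ 10 * ‖H.plusCoord (H.residual w ξ)‖ ≤ 4 / e ^ 10 * (2 * (1501 * e ^ 11)) := by
          gcongr
          exact (H.norm_plusCoord_le _).trans (by gcongr)
      _ = 12008 * e := by field_simp; ring
      _ ≤ 1 / 2 := by linarith
  · simp only [step]
    rw [norm_div]
    calc ‖H.minusCoord (H.residual w ξ)‖ / ‖H.value ξ - lam'‖ ≤ 2 * (1501 * e ^ 11) / e ^ 10 := by
          gcongr
          exact (H.norm_minusCoord_le _).trans (by gcongr)
      _ = 3002 * e := by field_simp; ring
      _ ≤ 1 / 2 := by linarith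
  · simp only [step]
    rw [norm_smul, Complex.norm_real, norm_neg, Real.norm_of_nonneg (by positivity)]
    calc 1 / e ^ 2 * ‖H.applyMul (H.value ξ) (conv w (H.vec ξ))‖
        ≤ 1 / e ^ 2 * (2 / e ^ 6 * (2 * e ^ 9 * 5)) := by
          gcongr
          refine (H.norm_applyMul_le _ _).trans ?_
          gcongr
          exact (norm_conv_le _ _).trans (mul_le_mul (H.norm_perturbed_le hw) (H.norm_vec_le hξ)
            (norm_nonneg _) (by positivity))
      _ = 20 * e := by field_simp; ring
      _ ≤ 1 / 2 := by linarith

/-- Contraction in `ξ` and Lipschitz dependence on the potential in one estimate. The constant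
`40/e¹⁰` comes from the first entry: `4/e¹⁰`, times `2` for the coordinate, times `5` for the norm
of the vector. -/
theorem norm_step_sub_le (H : TwoLevel e d v j q lam lam' α β) {w w' : Seq 1}
    {ξ ξ' : ℂ × ℂ × Seq p} (hw : ‖w - v‖ ≤ 300 * e ^ 11) (hw' : ‖w' - v‖ ≤ 300 * e ^ 11)
    (hξ : ‖ξ‖ ≤ 1) (hξ' : ‖ξ'‖ ≤ 1) :
    ‖H.step w ξ - H.step w' ξ'‖ ≤ 1 / 2 * ‖ξ - ξ'‖ + 40 / e ^ 10 * ‖w - w'‖ := by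
  have he := H.pos
  have hs := H.small
  have hr := H.norm_residual_le hw' hξ'
  have hrs := H.norm_residual_sub_le (w' := w') (ξ := ξ) hw hξ'
  have hz := H.norm_value_sub_le hξ
  have hz' := H.norm_value_sub_le hξ'
  have h10 := H.le_norm_value_sub hz
  have h10' := H.le_norm_value_sub hz'
  have hzz := H.norm_value_sub_value_le ξ ξ'
  have hδ := norm_nonneg (ξ - ξ')
  have hΔ := norm_nonneg (w - w')
  set δ := ‖ξ - ξ'‖
  set Δ := ‖w - w'‖
  refine norm_prod_le_iff.2 ⟨?_, norm_prod_le_iff.2 ⟨?_, ?_⟩⟩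
  · simp only [step, Prod.fst_sub]
    rw [← mul_sub, ← plusCoord_sub, norm_mul, Complex.norm_real, Real.norm_of_nonneg (by positivity)]
    calc 4 / e ^ 10 * ‖H.plusCoord (H.residual w ξ - H.residual w' ξ')‖
        ≤ 4 / e ^ 10 * (2 * (901 * e ^ 11 * δ + 5 * Δ)) := by
          gcongr
          exact (H.norm_plusCoord_le _).trans (by gcongr)
      _ = 7208 * e * δ + 40 / e ^ 10 * Δ := by field_simp; ring
      _ ≤ _ := by gcongr; linarith
  · simp only [step, Prod.snd_sub, Prod.fst_sub]
    refine (norm_div_sub_div_le (pow_pos he 10) h10 h10').trans ?_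
    rw [← minusCoord_sub, sub_sub_sub_cancel_right]
    calc ‖H.minusCoord (H.residual w ξ - H.residual w' ξ')‖ / e ^ 10 +
          ‖H.minusCoord (H.residual w' ξ')‖ * ‖H.value ξ - H.value ξ'‖ / (e ^ 10) ^ 2
        ≤ 2 * (901 * e ^ 11 * δ + 5 * Δ) / e ^ 10 +
          2 * (1501 * e ^ 11) * (e ^ 10 / 4 * δ) / (e ^ 10) ^ 2 := by
          gcongr
          · exact (H.norm_minusCoord_le _).trans (by gcongr)
          · exact (H.norm_minusCoord_le _).trans (by gcongr)
      _ = 2552.5 * e * δ + 10 / e ^ 10 * Δ := by field_simp; ring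
      _ ≤ _ := by gcongr <;> linarith
  · simp only [step, Prod.snd_sub]
    rw [← smul_sub, norm_smul, Complex.norm_real, norm_neg, Real.norm_of_nonneg (by positivity)]
    have hc : ‖conv w (H.vec ξ) - conv w' (H.vec ξ')‖ ≤ 2 * e ^ 9 * (3 * δ) + Δ * 5 := by
      have : conv w (H.vec ξ) - conv w' (H.vec ξ') =
          conv w (H.vec ξ - H.vec ξ') + conv (w - w') (H.vec ξ') := by
        rw [conv_sub_right, conv_sub_left]; abel
      rw [this]
      exact norm_add_le_of_le ((norm_conv_le _ _).trans (mul_le_mul (H.norm_perturbed_le hw)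
          (H.norm_vec_sub_le ξ ξ') (norm_nonneg _) (by positivity)))
        ((norm_conv_le _ _).trans (mul_le_mul_of_nonneg_left (H.norm_vec_le hξ') hΔ))
    have hc' : ‖conv w' (H.vec ξ')‖ ≤ 2 * e ^ 9 * 5 :=
      (norm_conv_le _ _).trans (mul_le_mul (H.norm_perturbed_le hw') (H.norm_vec_le hξ')
        (norm_nonneg _) (by positivity))
    calc 1 / e ^ 2 * ‖H.applyMul (H.value ξ) (conv w (H.vec ξ)) -
            H.applyMul (H.value ξ') (conv w' (H.vec ξ'))‖
        ≤ 1 / e ^ 2 * (2 / e ^ 6 * (2 * e ^ 9 * (3 * δ) + Δ * 5) +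
            4 / e ^ 12 * (e ^ 10 / 4 * δ) * (2 * e ^ 9 * 5)) := by
          gcongr
          refine (H.norm_applyMul_sub_le hz hz' _ _).trans ?_
          gcongr
      _ = (12 * e + 10 * e ^ 5) * δ + 10 * e ^ 2 / e ^ 10 * Δ := by field_simp; ring
      _ ≤ _ := by
        have h2 : e ^ 2 ≤ 1 := pow_le_one₀ he.le (by linarith)
        have h5 : e ^ 5 ≤ e := by
          simpa using pow_le_pow_of_le_one he.le (by linarith) (by norm_num : 1 ≤ 5)
        gcongr <;> linarith

end TwoLevel

/-! ### Normalized eigenvectors are exactly the fixed points. -/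

/-- `f` is an eigenvector of the operator with matrix `d_m δ_{mn} + w_{m-n}`. -/
def IsEigen (d : Lattice → ℝ) (w : Seq 1) (μ : ℂ) (f : Lattice → ℂ) : Prop :=
  ∀ m, (d m : ℂ) * f m + ∑' n, w (m - n) * f n = μ * f m

namespace TwoLevel

variable {e : ℝ} {d : Lattice → ℝ} {v : Seq 1} {j q : Lattice} {lam lam' : ℝ} {α β : ℂ}
  {p : ℝ≥0∞} [hp1 : Fact (1 ≤ p)]

/-- The components of `f` outside the two levels. -/
def tail (H : TwoLevel e d v j q lam lam' α β) (f : Seq p) : Seq p :=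
  f - (H.plusCoord f • H.plusVec p + H.minusCoord f • H.minusVec p)

theorem plusVec_fst (H : TwoLevel e d v j q lam lam' α β) : H.plusVec p j = α := by
  simp [plusVec, H.ne_zero]

theorem plusVec_snd (H : TwoLevel e d v j q lam lam' α β) : H.plusVec p (j - q) = β := by
  simp [plusVec, H.ne_zero]

theorem minusVec_fst (H : TwoLevel e d v j q lam lam' α β) : H.minusVec p j = -conj β := by
  simp [minusVec, H.ne_zero]

theorem minusVec_snd (H : TwoLevel e d v j q lam lam' α β) : H.minusVec p (j - q) = conj α := by
  simp [minusVec, H.ne_zero]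

theorem plusVec_other (H : TwoLevel e d v j q lam lam' α β) {m : Lattice} (hm : m ≠ j)
    (hm' : m ≠ j - q) : H.plusVec p m = 0 := by
  simp [plusVec, hm, hm']

theorem minusVec_other (H : TwoLevel e d v j q lam lam' α β) {m : Lattice} (hm : m ≠ j)
    (hm' : m ≠ j - q) : H.minusVec p m = 0 := by
  simp [minusVec, hm, hm']

theorem fst_eq (H : TwoLevel e d v j q lam lam' α β) (f : Seq p) :
    f j = H.plusCoord f * α - H.minusCoord f * conj β := by
  simp only [plusCoord, minusCoord]
  linear_combination (-f j) * H.unit_complex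

theorem snd_eq (H : TwoLevel e d v j q lam lam' α β) (f : Seq p) :
    f (j - q) = H.plusCoord f * β + H.minusCoord f * conj α := by
  simp only [plusCoord, minusCoord]
  linear_combination (-f (j - q)) * H.unit_complex

theorem tail_fst (H : TwoLevel e d v j q lam lam' α β) (f : Seq p) : H.tail f j = 0 := by
  simp only [tail, lp.coeFn_sub, lp.coeFn_add, lp.coeFn_smul, Pi.sub_apply, Pi.add_apply,
    Pi.smul_apply, smul_eq_mul, plusVec_fst, minusVec_fst]
  linear_combination H.fst_eq f

theorem tail_snd (H : TwoLevel e d v j q lam lam' α β) (f : Seq p) : H.tail f (j - q) = 0 := by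
  simp only [tail, lp.coeFn_sub, lp.coeFn_add, lp.coeFn_smul, Pi.sub_apply, Pi.add_apply,
    Pi.smul_apply, smul_eq_mul, plusVec_snd, minusVec_snd]
  linear_combination H.snd_eq f

theorem tail_other (H : TwoLevel e d v j q lam lam' α β) (f : Seq p) {m : Lattice} (hm : m ≠ j)
    (hm' : m ≠ j - q) : H.tail f m = f m := by
  simp only [tail, lp.coeFn_sub, lp.coeFn_add, lp.coeFn_smul, Pi.sub_apply, Pi.add_apply,
    Pi.smul_apply, H.plusVec_other hm hm', H.minusVec_other hm hm']
  simp

/-- The perturbation of the model, applied to `f`. -/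
def perturb (H : TwoLevel e d v j q lam lam' α β) (w : Seq 1) (f : Seq p) : Seq p :=
  conv (w - v) f + conv v (H.tail f)

/-- Isolates the action of `v` on the two resonant components. At the frequencies `j` and `j - q`
these terms reduce to the off-diagonal entries of the model matrix, since `v 0 = 0`; what remains is
the small `perturb`. -/
theorem conv_eq (H : TwoLevel e d v j q lam lam' α β) (w : Seq 1) (f : Seq p) (m : Lattice) :
    conv w f m = H.perturb w f m + v (m - j) * f j + v (m - (j - q)) * f (j - q) := by
  have h1 : conv w f = H.perturb w f + (H.plusCoord f • conv v (H.plusVec p) +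
      H.minusCoord f • conv v (H.minusVec p)) := by
    simp only [perturb, tail, conv_sub_left, conv_sub_right, conv_add_right, conv_smul_right]
    abel
  have h2 : ∀ a b : ℂ, conv v (lp.single p j a + lp.single p (j - q) b) m =
      v (m - j) * a + v (m - (j - q)) * b := by
    intro a b
    rw [conv_add_right, lp.coeFn_add, Pi.add_apply, conv_single, conv_single]
  rw [h1]
  simp only [lp.coeFn_add, lp.coeFn_smul, Pi.add_apply, Pi.smul_apply, smul_eq_mul, plusVec,
    minusVec, h2]
  rw [H.fst_eq f, H.snd_eq f]
  ring

theorem conv_fst (H : TwoLevel e d v j q lam lam' α β) (w : Seq 1) (f : Seq p) :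
    conv w f j = H.perturb w f j + v q * f (j - q) := by
  rw [H.conv_eq, sub_self, H.coeff_zero, sub_sub_cancel]
  ring

theorem conv_snd (H : TwoLevel e d v j q lam lam' α β) (w : Seq 1) (f : Seq p) :
    conv w f (j - q) = H.perturb w f (j - q) + conj (v q) * f j := by
  rw [H.conv_eq, sub_self, H.coeff_zero, sub_sub_cancel_left, H.coeff_neg]
  ring

theorem eigen_minus_fst (H : TwoLevel e d v j q lam lam' α β) :
    -(d j : ℂ) * conj β + v q * conj α = -lam' * conj β := by
  have h1 := congrArg conj H.eigen_snd
  have h2 : (lam : ℂ) + lam' = d j + d (j - q) := by exact_mod_cast H.trace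
  simp only [map_add, map_mul, Complex.conj_conj, Complex.conj_ofReal] at h1
  linear_combination h1 + conj β * h2

theorem eigen_minus_snd (H : TwoLevel e d v j q lam lam' α β) :
    -conj (v q) * conj β + (d (j - q) : ℂ) * conj α = lam' * conj α := by
  have h1 := congrArg conj H.eigen_fst
  have h2 : (lam : ℂ) + lam' = d j + d (j - q) := by exact_mod_cast H.trace
  simp only [map_add, map_mul, Complex.conj_ofReal] at h1
  linear_combination (-1 : ℂ) * h1 - conj α * h2

/-- The two equations at the resonant frequencies, in the eigenbasis of the model matrix. -/
theorem two_level_iff (H : TwoLevel e d v j q lam lam' α β) (w : Seq 1) (μ : ℂ) (f : Seq p) :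
    ((d j : ℂ) * f j + conv w f j = μ * f j ∧
      (d (j - q) : ℂ) * f (j - q) + conv w f (j - q) = μ * f (j - q)) ↔
    (H.plusCoord (H.perturb w f) = (μ - lam) * H.plusCoord f ∧
      H.minusCoord (H.perturb w f) = (μ - lam') * H.minusCoord f) := by
  rw [H.conv_fst, H.conv_snd, H.fst_eq f, H.snd_eq f]
  generalize H.plusCoord f = a
  generalize H.minusCoord f = b
  have h1 := H.eigen_fst
  have h2 := H.eigen_snd
  have h3 := H.eigen_minus_fst
  have h4 := H.eigen_minus_snd
  have h5 := H.unit_complex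
  constructor
  · rintro ⟨ha, hb⟩
    -- The model eigenvectors form an orthonormal basis, so the coordinates in this basis are
    -- combinations of the two equations with the conjugated entries of the eigenvectors as weights;
    -- the converse direction expands in the basis.
    simp only [plusCoord, minusCoord]
    constructor
    · linear_combination conj α * ha + conj β * hb - a * conj α * h1 - b * conj α * h3 -
        a * conj β * h2 - b * conj β * h4 + (μ - lam) * a * h5
    · linear_combination (-β) * ha + α * hb + a * β * h1 + b * β * h3 - a * α * h2 -
        b * α * h4 + (μ - lam') * b * h5
  · rintro ⟨ha, hb⟩
    rw [H.fst_eq (H.perturb w f), H.snd_eq (H.perturb w f), ha, hb]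
    constructor
    · linear_combination a * h1 + b * h3
    · linear_combination a * h2 + b * h4

theorem plusCoord_vec (H : TwoLevel e d v j q lam lam' α β) {ξ : ℂ × ℂ × Seq p}
    (h1 : ξ.2.2 j = 0) (h2 : ξ.2.2 (j - q) = 0) : H.plusCoord (H.vec ξ) = 1 := by
  simp only [plusCoord, vec, head, lp.coeFn_add, lp.coeFn_smul, Pi.add_apply, Pi.smul_apply,
    smul_eq_mul, plusVec_fst, plusVec_snd, minusVec_fst, minusVec_snd, h1, h2]
  linear_combination H.unit_complex

theorem minusCoord_vec (H : TwoLevel e d v j q lam lam' α β) {ξ : ℂ × ℂ × Seq p}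
    (h1 : ξ.2.2 j = 0) (h2 : ξ.2.2 (j - q) = 0) : H.minusCoord (H.vec ξ) = ξ.2.1 := by
  simp only [minusCoord, vec, head, lp.coeFn_add, lp.coeFn_smul, Pi.add_apply, Pi.smul_apply,
    smul_eq_mul, plusVec_fst, plusVec_snd, minusVec_fst, minusVec_snd, h1, h2]
  linear_combination ξ.2.1 * H.unit_complex

theorem tail_vec (H : TwoLevel e d v j q lam lam' α β) {ξ : ℂ × ℂ × Seq p}
    (h1 : ξ.2.2 j = 0) (h2 : ξ.2.2 (j - q) = 0) :
    H.tail (H.vec ξ) = ((e ^ 2 : ℝ) : ℂ) • ξ.2.2 := by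
  rw [tail, H.plusCoord_vec h1 h2, H.minusCoord_vec h1 h2, vec, head]
  simp

theorem residual_eq_perturb (H : TwoLevel e d v j q lam lam' α β) (w : Seq 1)
    {ξ : ℂ × ℂ × Seq p} (h1 : ξ.2.2 j = 0) (h2 : ξ.2.2 (j - q) = 0) :
    H.residual w ξ = H.perturb w (H.vec ξ) := by
  rw [perturb, H.tail_vec h1 h2, conv_smul_right, residual]

theorem step_tail_apply (H : TwoLevel e d v j q lam lam' α β) (w : Seq 1) (ξ : ℂ × ℂ × Seq p)
    (m : Lattice) : (H.step w ξ).2.2 m =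
      ((-(1 / e ^ 2) : ℝ) : ℂ) * (H.multiplier (H.value ξ) m * conv w (H.vec ξ) m) := rfl

theorem fixed_fst (H : TwoLevel e d v j q lam lam' α β) {w : Seq 1} {ξ : ℂ × ℂ × Seq p}
    (h : H.step w ξ = ξ) : ξ.2.2 j = 0 := by
  rw [← h, step_tail_apply]
  simp [multiplier]

theorem fixed_snd (H : TwoLevel e d v j q lam lam' α β) {w : Seq 1} {ξ : ℂ × ℂ × Seq p}
    (h : H.step w ξ = ξ) : ξ.2.2 (j - q) = 0 := by
  rw [← h, step_tail_apply]
  simp [multiplier]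

theorem sub_other_ne_zero (H : TwoLevel e d v j q lam lam' α β) {z : ℂ}
    (hz : ‖z - lam‖ ≤ e ^ 10 / 4) : z - lam' ≠ 0 :=
  norm_pos_iff.1 ((pow_pos H.pos 10).trans_le (H.le_norm_value_sub hz))

theorem sub_diag_ne_zero (H : TwoLevel e d v j q lam lam' α β) {z : ℂ}
    (hz : ‖z - lam‖ ≤ e ^ 10 / 4) {m : Lattice} (hm : m ≠ j) (hm' : m ≠ j - q) :
    (d m : ℂ) - z ≠ 0 :=
  norm_pos_iff.1 ((by have := H.pos; positivity : 0 < e ^ 6 / 2).trans_le (H.le_norm_sub hz hm hm'))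

/-- Fixed points are eigenvectors. -/
theorem isEigen_of_fixed (H : TwoLevel e d v j q lam lam' α β) {w : Seq 1} {ξ : ℂ × ℂ × Seq p}
    (hξ : ‖ξ‖ ≤ 1) (h : H.step w ξ = ξ) : IsEigen d w (H.value ξ) (H.vec ξ) := by
  have he : (e : ℂ) ≠ 0 := Complex.ofReal_ne_zero.2 H.pos.ne'
  have hz := H.norm_value_sub_le hξ
  have h1 := H.fixed_fst h
  have h2 := H.fixed_snd h
  have h3 : ((4 / e ^ 10 : ℝ) : ℂ) * H.plusCoord (H.residual w ξ) = ξ.1 := congrArg Prod.fst h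
  have h4 : H.minusCoord (H.residual w ξ) / (H.value ξ - lam') = ξ.2.1 :=
    congrArg (fun x => x.2.1) h
  rw [H.residual_eq_perturb w h1 h2] at h3 h4
  have h5 := (H.two_level_iff w (H.value ξ) (H.vec ξ)).2 ⟨by
    rw [H.plusCoord_vec h1 h2, value, ← h3]
    push_cast
    field_simp
    ring, by
    rw [H.minusCoord_vec h1 h2, ← h4]
    exact (mul_div_cancel₀ _ (H.sub_other_ne_zero hz)).symm⟩
  intro m
  rw [← conv_apply]
  by_cases hm : m = j
  · rw [hm]; exact h5.1
  by_cases hm' : m = j - q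
  · rw [hm']; exact h5.2
  have h6 : H.vec ξ m = ((e ^ 2 : ℝ) : ℂ) * ξ.2.2 m := by
    rw [← H.tail_other _ hm hm', H.tail_vec h1 h2]
    rfl
  have h7 : ξ.2.2 m = _ := (congrArg (fun x => x.2.2 m) h).symm
  rw [step_tail_apply, H.multiplier_eq hz hm hm'] at h7
  have h8 := H.sub_diag_ne_zero hz hm hm'
  have h9 : ((d m : ℂ) - H.value ξ) * H.vec ξ m = -conv w (H.vec ξ) m := by
    rw [h6, h7]
    push_cast
    field_simp
  linear_combination h9

/-- The coordinates of a normalized eigenvector. -/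
def coords (H : TwoLevel e d v j q lam lam' α β) (μ : ℂ) (f : Seq p) : ℂ × ℂ × Seq p :=
  (((4 / e ^ 10 : ℝ) : ℂ) * (μ - lam), H.minusCoord f, ((1 / e ^ 2 : ℝ) : ℂ) • H.tail f)

theorem vec_coords (H : TwoLevel e d v j q lam lam' α β) (μ : ℂ) {f : Seq p}
    (hf : H.plusCoord f = 1) : H.vec (H.coords μ f) = f := by
  have he : (e : ℂ) ≠ 0 := Complex.ofReal_ne_zero.2 H.pos.ne'
  have h1 : ((e ^ 2 : ℝ) : ℂ) * ((1 / e ^ 2 : ℝ) : ℂ) = 1 := by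
    push_cast
    field_simp
  simp only [vec, head, coords, smul_smul, h1, tail, hf, one_smul]
  abel

theorem value_coords (H : TwoLevel e d v j q lam lam' α β) (μ : ℂ) (f : Seq p) :
    H.value (H.coords μ f) = μ := by
  have he : (e : ℂ) ≠ 0 := Complex.ofReal_ne_zero.2 H.pos.ne'
  simp only [value, coords]
  push_cast
  field_simp
  ring

theorem tail_eq (H : TwoLevel e d v j q lam lam' α β) {w : Seq 1} {μ : ℂ} {f : Seq p}
    (hμ : ‖μ - lam‖ ≤ e ^ 10 / 4) (hf : IsEigen d w μ f) :
    H.tail f = -H.applyMul μ (conv w f) := by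
  ext m
  rw [lp.coeFn_neg, Pi.neg_apply, applyMul_apply]
  by_cases hm : m = j
  · rw [hm, H.tail_fst]; simp [multiplier]
  by_cases hm' : m = j - q
  · rw [hm', H.tail_snd]; simp [multiplier]
  have h1 := hf m
  rw [← conv_apply] at h1
  have h2 := H.sub_diag_ne_zero hμ hm hm'
  rw [H.tail_other f hm hm', H.multiplier_eq hμ hm hm']
  field_simp
  linear_combination h1

theorem norm_le_coords (H : TwoLevel e d v j q lam lam' α β) (f : Seq p) :
    ‖f‖ ≤ 2 * (‖H.plusCoord f‖ + ‖H.minusCoord f‖) + ‖H.tail f‖ := by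
  have h1 : f = H.plusCoord f • H.plusVec p + H.minusCoord f • H.minusVec p + H.tail f := by
    rw [tail]; abel
  have h2 : ‖H.plusCoord f • H.plusVec p‖ ≤ ‖H.plusCoord f‖ * 2 := by
    rw [norm_smul]
    exact mul_le_mul_of_nonneg_left H.norm_plusVec_le (norm_nonneg _)
  have h3 : ‖H.minusCoord f • H.minusVec p‖ ≤ ‖H.minusCoord f‖ * 2 := by
    rw [norm_smul]
    exact mul_le_mul_of_nonneg_left H.norm_minusVec_le (norm_nonneg _)
  have h4 := norm_add₃_le (a := H.plusCoord f • H.plusVec p) (b := H.minusCoord f • H.minusVec p)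
    (c := H.tail f)
  rw [← h1] at h4
  linarith

/-- The tail is `O(e³)` times the whole vector. The whole vector contains the tail again, and this
contribution is absorbed on the left. -/
theorem norm_tail_le (H : TwoLevel e d v j q lam lam' α β) {w : Seq 1} {μ : ℂ} {f : Seq p}
    (hw : ‖w - v‖ ≤ 300 * e ^ 11) (hμ : ‖μ - lam‖ ≤ e ^ 10 / 4) (hf : IsEigen d w μ f) :
    ‖H.tail f‖ ≤ 10 * e ^ 3 * (‖H.plusCoord f‖ + ‖H.minusCoord f‖) := by
  have he := H.pos
  have hs := H.small
  have h1 : ‖H.tail f‖ ≤ 4 * e ^ 3 * ‖f‖ := by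
    rw [H.tail_eq hμ hf, norm_neg]
    calc ‖H.applyMul μ (conv w f)‖ ≤ 2 / e ^ 6 * (2 * e ^ 9 * ‖f‖) := by
          refine (H.norm_applyMul_le _ _).trans ?_
          gcongr
          exact (norm_conv_le _ _).trans
            (mul_le_mul_of_nonneg_right (H.norm_perturbed_le hw) (norm_nonneg _))
      _ = 4 * e ^ 3 * ‖f‖ := by field_simp; ring
  have h2 := H.norm_le_coords f
  set a := ‖H.plusCoord f‖ + ‖H.minusCoord f‖
  have h3 : e ^ 3 ≤ 1 / 1000 := by
    have : e ^ 3 ≤ e := by simpa using pow_le_pow_of_le_one he.le (by linarith) (by norm_num : 1 ≤ 3)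
    linarith
  have h4 := pow_pos he 3
  have h5 : 4 * e ^ 3 * ‖f‖ ≤ 4 * e ^ 3 * (2 * a + ‖H.tail f‖) :=
    mul_le_mul_of_nonneg_left h2 (by positivity)
  have h6 : e ^ 3 * ‖H.tail f‖ ≤ 1 / 1000 * ‖H.tail f‖ :=
    mul_le_mul_of_nonneg_right h3 (norm_nonneg _)
  have h7 : 0 ≤ e ^ 3 * a := by positivity
  linarith

/-- In the equation along the other model eigenvector the factor `μ - lam'` is at least `e¹⁰` in
modulus, whereas the perturbation is `O(e¹¹)`. So this component is at most a thousandth of the sum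
of both. -/
theorem norm_minusCoord_le_of_isEigen (H : TwoLevel e d v j q lam lam' α β) {w : Seq 1} {μ : ℂ}
    {f : Seq p} (hw : ‖w - v‖ ≤ 300 * e ^ 11) (hμ : ‖μ - lam‖ ≤ e ^ 10 / 4)
    (hf : IsEigen d w μ f) : ‖H.minusCoord f‖ ≤ ‖H.plusCoord f‖ := by
  have he := H.pos
  have hs := H.small
  have h1 := H.norm_tail_le hw hμ hf
  have h2 := H.norm_le_coords f
  have h3 := ((H.two_level_iff w μ f).1 ⟨by rw [conv_apply]; exact hf j, by
    rw [conv_apply]; exact hf (j - q)⟩).2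
  have h4 : ‖H.perturb w f‖ ≤ 300 * e ^ 11 * ‖f‖ + e ^ 9 * ‖H.tail f‖ :=
    norm_add_le_of_le ((norm_conv_le _ _).trans (mul_le_mul_of_nonneg_right hw (norm_nonneg _)))
      ((norm_conv_le _ _).trans (mul_le_mul_of_nonneg_right H.norm_le (norm_nonneg _)))
  have h5 := H.norm_minusCoord_le (H.perturb w f)
  rw [h3, norm_mul] at h5
  have h6 := mul_le_mul_of_nonneg_right (H.le_norm_value_sub hμ) (norm_nonneg (H.minusCoord f))
  have ha := norm_nonneg (H.plusCoord f)
  have hb := norm_nonneg (H.minusCoord f)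
  set a := ‖H.plusCoord f‖
  set b := ‖H.minusCoord f‖
  have h3' : e ^ 3 ≤ 1 / 1000 := by
    have : e ^ 3 ≤ e := by simpa using pow_le_pow_of_le_one he.le (by linarith) (by norm_num : 1 ≤ 3)
    linarith
  have h7 : ‖f‖ ≤ 3 * (a + b) := by
    have : 10 * e ^ 3 * (a + b) ≤ 1 * (a + b) :=
      mul_le_mul_of_nonneg_right (by linarith) (by positivity)
    linarith
  have h8 : e ^ 10 * b ≤ e ^ 10 * (1 / 1000 * (a + b)) := by
    calc e ^ 10 * b ≤ 2 * (300 * e ^ 11 * (3 * (a + b)) + e ^ 9 * (10 * e ^ 3 * (a + b))) := by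
          refine h6.trans (h5.trans ?_)
          gcongr
          refine h4.trans ?_
          gcongr
      _ = e ^ 10 * ((1800 * e + 20 * e ^ 2) * (a + b)) := by ring
      _ ≤ _ := by
        gcongr
        nlinarith
  have h9 := le_of_mul_le_mul_left h8 (pow_pos he 10)
  linarith

/-- An eigenvector for an eigenvalue near the model eigenvalue has a component along the model
eigenvector. -/
theorem plusCoord_ne_zero (H : TwoLevel e d v j q lam lam' α β) {w : Seq 1} {μ : ℂ}
    {f : Seq p} (hw : ‖w - v‖ ≤ 300 * e ^ 11) (hμ : ‖μ - lam‖ ≤ e ^ 10 / 4)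
    (hf : IsEigen d w μ f) (h0 : f ≠ 0) : H.plusCoord f ≠ 0 := by
  intro ha
  have h1 := H.norm_tail_le hw hμ hf
  have h2 := H.norm_le_coords f
  have h3 := H.norm_minusCoord_le_of_isEigen hw hμ hf
  rw [ha, norm_zero] at h3
  have h4 : ‖H.minusCoord f‖ = 0 := le_antisymm h3 (norm_nonneg _)
  rw [ha, h4] at h1 h2
  simp only [norm_zero, add_zero, mul_zero, zero_add] at h1 h2
  exact h0 (norm_le_zero_iff.1 (h2.trans h1))

/-- Normalized eigenvectors are fixed points. -/
theorem fixed_of_isEigen (H : TwoLevel e d v j q lam lam' α β) {w : Seq 1} {μ : ℂ}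
    {f : Seq p} (hw : ‖w - v‖ ≤ 300 * e ^ 11) (hμ : ‖μ - lam‖ ≤ e ^ 10 / 4)
    (hf : IsEigen d w μ f) (ha : H.plusCoord f = 1) :
    ‖H.coords μ f‖ ≤ 1 ∧ H.step w (H.coords μ f) = H.coords μ f := by
  have he := H.pos
  have hs := H.small
  have heC : (e : ℂ) ≠ 0 := Complex.ofReal_ne_zero.2 H.pos.ne'
  have h1 := H.norm_tail_le hw hμ hf
  have h2 := H.norm_minusCoord_le_of_isEigen hw hμ hf
  rw [ha, norm_one] at h1 h2
  constructor
  · refine norm_prod_le_iff.2 ⟨?_, norm_prod_le_iff.2 ⟨h2, ?_⟩⟩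
    · simp only [coords]
      rw [norm_mul, Complex.norm_real, Real.norm_of_nonneg (by positivity)]
      calc 4 / e ^ 10 * ‖μ - lam‖ ≤ 4 / e ^ 10 * (e ^ 10 / 4) := by gcongr
        _ = 1 := by field_simp
    · simp only [coords]
      rw [norm_real_smul (by positivity)]
      calc 1 / e ^ 2 * ‖H.tail f‖ ≤ 1 / e ^ 2 * (10 * e ^ 3 * (1 + 1)) := by
            gcongr
            exact h1.trans (by gcongr)
        _ = 20 * e := by field_simp; norm_num
        _ ≤ 1 := by linarith
  · have hg : ((e ^ 2 : ℝ) : ℂ) * ((1 / e ^ 2 : ℝ) : ℂ) = 1 := by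
      push_cast
      field_simp
    have h3 := (H.two_level_iff w μ f).1 ⟨by rw [conv_apply]; exact hf j, by
      rw [conv_apply]; exact hf (j - q)⟩
    have h4 : H.residual w (H.coords μ f) = H.perturb w f := by
      rw [H.residual_eq_perturb w (by simp [coords, H.tail_fst]) (by simp [coords, H.tail_snd]),
        H.vec_coords μ ha]
    unfold step
    rw [h4, H.value_coords, H.vec_coords μ ha, h3.1, h3.2, ha, mul_one]
    refine Prod.ext rfl (Prod.ext ?_ ?_)
    · exact mul_div_cancel_left₀ _ (H.sub_other_ne_zero hμ)
    · simp only [coords]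
      rw [H.tail_eq hμ hf, smul_neg]
      push_cast
      rw [neg_smul]

/-- Banach's theorem on the closed unit ball; the fixed point inherits the bound `1/2` from the
range of `step`. -/
theorem exists_fixed (H : TwoLevel e d v j q lam lam' α β) {w : Seq 1}
    (hw : ‖w - v‖ ≤ 300 * e ^ 11) (p : ℝ≥0∞) [Fact (1 ≤ p)] :
    ∃ ξ : ℂ × ℂ × Seq p, ‖ξ‖ ≤ 1 / 2 ∧ H.step w ξ = ξ := by
  have hmaps : Set.MapsTo (H.step w) (Metric.closedBall (0 : ℂ × ℂ × Seq p) 1)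
      (Metric.closedBall 0 1) := fun ξ hξ => by
    rw [mem_closedBall_zero_iff] at hξ ⊢
    exact (H.norm_step_le hw hξ).trans (by norm_num)
  have hc : ContractingWith (1 / 2) (hmaps.restrict (H.step w) _ _) := by
    refine ⟨by norm_num, LipschitzWith.of_dist_le_mul fun ξ ξ' => ?_⟩
    have h1 := H.norm_step_sub_le hw hw (mem_closedBall_zero_iff.1 ξ.2)
      (mem_closedBall_zero_iff.1 ξ'.2)
    rw [sub_self, norm_zero, mul_zero, add_zero] at h1
    rw [Subtype.dist_eq, Subtype.dist_eq, dist_eq_norm, dist_eq_norm]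
    simpa using h1
  obtain ⟨ξ, hξ, hfix, -⟩ := hc.exists_fixedPoint' Metric.isClosed_closedBall.isComplete hmaps
    (mem_closedBall_zero_iff.2 (by simp) : (0 : ℂ × ℂ × Seq p) ∈ _) (edist_ne_top _ _)
  refine ⟨ξ, ?_, hfix⟩
  have h1 := H.norm_step_le hw (mem_closedBall_zero_iff.1 hξ)
  rwa [hfix.eq] at h1

/-- Half of the distance is absorbed on the left. With `w = w'` this gives uniqueness; in general it
controls how the eigenvector varies with the potential. -/
theorem fixed_sub_le (H : TwoLevel e d v j q lam lam' α β) {w w' : Seq 1}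
    {ξ ξ' : ℂ × ℂ × Seq p} (hw : ‖w - v‖ ≤ 300 * e ^ 11) (hw' : ‖w' - v‖ ≤ 300 * e ^ 11)
    (hξ : ‖ξ‖ ≤ 1) (hξ' : ‖ξ'‖ ≤ 1) (h : H.step w ξ = ξ) (h' : H.step w' ξ' = ξ') :
    ‖ξ - ξ'‖ ≤ 80 / e ^ 10 * ‖w - w'‖ := by
  have h1 := H.norm_step_sub_le hw hw' hξ hξ'
  rw [h, h'] at h1
  have h2 : 80 / e ^ 10 * ‖w - w'‖ = 2 * (40 / e ^ 10 * ‖w - w'‖) := by ring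
  linarith

theorem fixed_unique (H : TwoLevel e d v j q lam lam' α β) {w : Seq 1}
    {ξ ξ' : ℂ × ℂ × Seq p} (hw : ‖w - v‖ ≤ 300 * e ^ 11)
    (hξ : ‖ξ‖ ≤ 1) (hξ' : ‖ξ'‖ ≤ 1) (h : H.step w ξ = ξ) (h' : H.step w ξ' = ξ') : ξ = ξ' := by
  have h1 := H.fixed_sub_le hw hw hξ hξ' h h'
  rw [sub_self, norm_zero, mul_zero] at h1
  exact sub_eq_zero.1 (norm_le_zero_iff.1 h1)

end TwoLevel

/-! ### Self-adjointness -/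

theorem inner_shift (n : Lattice) (f g : Seq 2) :
    inner ℂ f (shift n g) = inner ℂ (shift (-n) f) g := by
  rw [lp.inner_eq_tsum, lp.inner_eq_tsum, ← (Equiv.addRight n).tsum_eq]
  simp

/-- The adjoint of a translation is the opposite translation, and reindexing `n ↦ -n` uses the
symmetry of `w`. -/
theorem inner_conv {w : Seq 1} (hw : ∀ n, w (-n) = conj (w n)) (f g : Seq 2) :
    inner ℂ f (conv w g) = inner ℂ (conv w f) g := by
  have h1 : inner ℂ f (conv w g) = ∑' n, w n * inner ℂ (shift (-n) f) g := by
    have h := (innerSL ℂ f).map_tsum (summable_norm_conv w g).of_norm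
    simpa [conv, inner_shift, inner_smul_right] using h
  have h2 : inner ℂ g (conv w f) = ∑' n, w n * inner ℂ g (shift n f) := by
    have h := (innerSL ℂ g).map_tsum (summable_norm_conv w f).of_norm
    simpa [conv, inner_smul_right] using h
  rw [h1, ← inner_conj_symm, h2, Complex.conj_tsum, ← (Equiv.neg Lattice).tsum_eq]
  simp [hw, inner_conj_symm]

theorem IsEigen.smul {d : Lattice → ℝ} {w : Seq 1} {μ : ℂ} {f : Lattice → ℂ}
    (hf : IsEigen d w μ f) (c : ℂ) : IsEigen d w μ (c • f) := fun m => by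
  simp only [Pi.smul_apply, smul_eq_mul, mul_left_comm _ c, tsum_mul_left]
  linear_combination c * hf m

/-- The eigenvalues of the operator with real `d` and Hermitian `w` are real. -/
theorem IsEigen.conj_eq {d : Lattice → ℝ} {w : Seq 1} (hw : ∀ n, w (-n) = conj (w n)) {μ : ℂ}
    {f : Seq 2} (hf : IsEigen d w μ f) (h0 : f ≠ 0) : conj μ = μ := by
  -- The diagonal is unbounded, but by the eigenvalue equation `d f` equals `μ f - w * f`, which
  -- lies in `ℓ²`. Its inner product with `f` is a real sum, and so is that of `w * f`; hence `μ
  -- ‖f‖²` is real.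
  have h1 : inner ℂ f (μ • f - conv w f) = ∑' m, ((d m * ‖f m‖ ^ 2 : ℝ) : ℂ) := by
    rw [lp.inner_eq_tsum]
    refine tsum_congr fun m => ?_
    have h2 : (μ • f - conv w f) m = (d m : ℂ) * f m := by
      have := hf m
      rw [← conv_apply] at this
      rw [lp.coeFn_sub, lp.coeFn_smul, Pi.sub_apply, Pi.smul_apply, smul_eq_mul]
      linear_combination -this
    rw [h2, RCLike.inner_apply]
    push_cast
    rw [← Complex.mul_conj']
    ring
  rw [← Complex.ofReal_tsum, inner_sub_right, inner_smul_right] at h1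
  have h2 := congrArg conj h1
  rw [map_sub, map_mul, Complex.conj_ofReal, inner_conj_symm, inner_conj_symm,
    ← inner_conv hw, ← h1, sub_left_inj] at h2
  exact mul_right_cancel₀ (inner_self_ne_zero.2 h0) h2

/-! ### Comparison of `ℓ¹` and `ℓ²` -/

/-- The inclusion of `ℓ¹` in `ℓ²`. -/
def toL2 (f : Seq 1) : Seq 2 := ⟨f, (lp.memℓp f).of_exponent_ge one_le_two⟩

@[simp] theorem toL2_apply (f : Seq 1) (m : Lattice) : toL2 f m = f m := rfl

theorem IsEigen.toL2 {d : Lattice → ℝ} {w : Seq 1} {μ : ℂ} {f : Seq 1} (hf : IsEigen d w μ f) :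
    IsEigen d w μ (toL2 f) := fun m => by
  simp only [toL2_apply]
  exact hf m

theorem toL2_sub (f g : Seq 1) : toL2 (f - g) = toL2 f - toL2 g := by
  ext m
  simp only [toL2_apply, lp.coeFn_sub, Pi.sub_apply]

theorem norm_toL2_le (f : Seq 1) : ‖toL2 f‖ ≤ ‖f‖ := by
  have h1 : ‖toL2 f‖ ^ 2 = ∑' m, ‖f m‖ ^ 2 := by
    simpa using lp.norm_rpow_eq_tsum (p := 2) (by norm_num) (toL2 f)
  have h2 : ∀ m, ‖f m‖ ^ 2 ≤ ‖f m‖ * ‖f‖ := fun m => by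
    rw [sq]
    exact mul_le_mul_of_nonneg_left (norm_apply_le f m) (norm_nonneg _)
  have h3 := (summable_norm f).mul_right ‖f‖
  have h4 := (Summable.of_nonneg_of_le (fun _ => by positivity) h2 h3).tsum_le_tsum h2 h3
  rw [← h1, tsum_mul_right, ← norm_eq_tsum, ← sq] at h4
  exact (pow_le_pow_iff_left₀ (norm_nonneg _) (norm_nonneg _) two_ne_zero).1 h4

/-- The `j`-th column of the orthogonal projection on the line spanned by `f`. -/
def lineProjection (j : Lattice) (f : Seq 1) : Seq 1 :=
  (conj (f j) / (‖toL2 f‖ ^ 2 : ℝ) : ℂ) • f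

theorem starProjection_span (j : Lattice) (f : Seq 1) (m : Lattice) :
    (ℂ ∙ toL2 f).starProjection (lp.single 2 j (1 : ℂ)) m = lineProjection j f m := by
  rw [Submodule.starProjection_singleton, lp.inner_single_right, RCLike.inner_apply]
  simp [lineProjection]

theorem norm_lineProjection_le (j : Lattice) {f : Seq 1} (h1 : 1 / 2 ≤ ‖toL2 f‖)
    (h2 : ‖f‖ ≤ 5) : ‖lineProjection j f‖ ≤ 10 := by
  have h3 : ‖f j‖ ≤ ‖toL2 f‖ := norm_apply_le (toL2 f) j
  have h4 : 0 < ‖toL2 f‖ := by linarith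
  rw [lineProjection, norm_smul, norm_div, RCLike.norm_conj, Complex.norm_real,
    Real.norm_of_nonneg (by positivity)]
  calc ‖f j‖ / ‖toL2 f‖ ^ 2 * ‖f‖ ≤ ‖toL2 f‖ / ‖toL2 f‖ ^ 2 * 5 := by gcongr
    _ = 5 / ‖toL2 f‖ := by field_simp
    _ ≤ 5 / (1 / 2) := by gcongr
    _ = 10 := by norm_num

/-- The lower bound on the `ℓ²` norms keeps the denominators above `1/4`. The constant is `20 + 5 ·
804`, from the variation of the vector and of the scalar factor. -/
theorem norm_lineProjection_sub_le (j : Lattice) {f g : Seq 1} (hf : 1 / 2 ≤ ‖toL2 f‖)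
    (hf' : ‖f‖ ≤ 5) (hg : 1 / 2 ≤ ‖toL2 g‖) (hg' : ‖g‖ ≤ 5) :
    ‖lineProjection j f - lineProjection j g‖ ≤ 4040 * ‖f - g‖ := by
  have hF : ‖toL2 f‖ ≤ 5 := (norm_toL2_le f).trans hf'
  have hG : ‖toL2 g‖ ≤ 5 := (norm_toL2_le g).trans hg'
  have hδ : |‖toL2 f‖ - ‖toL2 g‖| ≤ ‖f - g‖ :=
    (abs_norm_sub_norm_le _ _).trans (toL2_sub f g ▸ norm_toL2_le (f - g))
  have hj : ‖f j‖ ≤ 5 := (norm_apply_le f j).trans hf'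
  have hgj : ‖g j‖ ≤ 5 := (norm_apply_le g j).trans hg'
  have hs : ‖f j - g j‖ ≤ ‖f - g‖ := norm_apply_le (f - g) j
  set a := ‖toL2 f‖
  set b := ‖toL2 g‖
  set δ := ‖f - g‖
  have hδ0 : 0 ≤ δ := norm_nonneg _
  have ha : (1 / 4 : ℝ) ≤ ‖((a ^ 2 : ℝ) : ℂ)‖ := by
    rw [Complex.norm_real, Real.norm_of_nonneg (by positivity)]
    nlinarith
  have hb : (1 / 4 : ℝ) ≤ ‖((b ^ 2 : ℝ) : ℂ)‖ := by
    rw [Complex.norm_real, Real.norm_of_nonneg (by positivity)]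
    nlinarith
  have hab : ‖((a ^ 2 : ℝ) : ℂ) - ((b ^ 2 : ℝ) : ℂ)‖ ≤ 10 * δ := by
    rw [← Complex.ofReal_sub, Complex.norm_real, Real.norm_eq_abs, sq_sub_sq, abs_mul,
      abs_of_nonneg (by positivity)]
    exact mul_le_mul (by linarith) hδ (abs_nonneg _) (by norm_num)
  have h1 : ‖conj (f j) / (a ^ 2 : ℝ) - conj (g j) / (b ^ 2 : ℝ)‖ ≤ 804 * δ := by
    refine (TwoLevel.norm_div_sub_div_le (by norm_num : (0 : ℝ) < 1 / 4) ha hb).trans ?_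
    rw [← map_sub, RCLike.norm_conj, RCLike.norm_conj]
    calc ‖f j - g j‖ / (1 / 4) + ‖g j‖ * ‖((a ^ 2 : ℝ) : ℂ) - ((b ^ 2 : ℝ) : ℂ)‖ / (1 / 4) ^ 2
        ≤ δ / (1 / 4) + 5 * (10 * δ) / (1 / 4) ^ 2 := by gcongr
      _ = 804 * δ := by ring
  have h2 : ‖conj (f j) / (a ^ 2 : ℝ)‖ ≤ 20 := by
    rw [norm_div, RCLike.norm_conj]
    calc ‖f j‖ / ‖((a ^ 2 : ℝ) : ℂ)‖ ≤ 5 / (1 / 4) := by gcongr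
      _ = 20 := by norm_num
  have h3 : lineProjection j f - lineProjection j g =
      (conj (f j) / (a ^ 2 : ℝ) : ℂ) • (f - g) +
      (conj (f j) / (a ^ 2 : ℝ) - conj (g j) / (b ^ 2 : ℝ) : ℂ) • g := by
    rw [lineProjection, lineProjection, smul_sub, sub_smul]
    abel
  rw [h3]
  refine (norm_add_le _ _).trans ?_
  rw [norm_smul, norm_smul]
  calc _ ≤ 20 * δ + 804 * δ * 5 := by gcongr
    _ = 4040 * δ := by ring

namespace TwoLevel

variable {e : ℝ} {d : Lattice → ℝ} {v : Seq 1} {j q : Lattice} {lam lam' : ℝ} {α β : ℂ}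

/-! ### The eigenvalue near the model eigenvalue -/

/-- `f` is the normalized eigenvector and `μ` the eigenvalue near the model eigenvalue. -/
structure Eigenpair (H : TwoLevel e d v j q lam lam' α β) (w : Seq 1) (f : Seq 1) (μ : ℝ) :
    Prop where
  eigen : IsEigen d w μ f
  normalized : H.plusCoord f = 1
  near : |μ - lam| < e ^ 10 / 4

theorem norm_ofReal_sub (a b : ℝ) : ‖(a : ℂ) - b‖ = |a - b| := by
  rw [← Complex.ofReal_sub, Complex.norm_real, Real.norm_eq_abs]

theorem exists_eigenpair (H : TwoLevel e d v j q lam lam' α β) {w : Seq 1}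
    (hw : ‖w - v‖ ≤ 300 * e ^ 11) (hh : ∀ n, w (-n) = conj (w n)) :
    ∃ f μ, H.Eigenpair w f μ := by
  obtain ⟨ξ, hξ, hfix⟩ := H.exists_fixed hw 1
  have h1 : ‖ξ‖ ≤ 1 := hξ.trans (by norm_num)
  have h2 := H.isEigen_of_fixed h1 hfix
  have h3 := H.plusCoord_vec (H.fixed_fst hfix) (H.fixed_snd hfix)
  have h0 : toL2 (H.vec ξ) ≠ 0 := by
    intro h
    have h4 : ∀ m, H.vec ξ m = 0 := fun m => by rw [← toL2_apply, h]; rfl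
    rw [plusCoord, h4, h4] at h3
    simp at h3
  have h4 : conj (H.value ξ) = H.value ξ := IsEigen.conj_eq hh h2.toL2 h0
  obtain ⟨μ, hμ⟩ := Complex.conj_eq_iff_real.1 h4
  refine ⟨H.vec ξ, μ, hμ ▸ h2, h3, ?_⟩
  rw [← norm_ofReal_sub, ← hμ, value, add_sub_cancel_left, norm_mul, Complex.norm_real,
    Real.norm_of_nonneg (by have := H.pos; positivity)]
  have h5 : ‖ξ.1‖ ≤ 1 / 2 := (norm_fst_le ξ).trans hξ
  nlinarith [pow_pos H.pos 10]

section

variable {w w' f f' : Seq 1} {μ μ' : ℝ}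

theorem Eigenpair.near_complex {H : TwoLevel e d v j q lam lam' α β} (h : H.Eigenpair w f μ) :
    ‖(μ : ℂ) - lam‖ ≤ e ^ 10 / 4 := by
  rw [norm_ofReal_sub]
  exact h.near.le

theorem Eigenpair.norm_le {H : TwoLevel e d v j q lam lam' α β} (h : H.Eigenpair w f μ)
    (hw : ‖w - v‖ ≤ 300 * e ^ 11) : ‖f‖ ≤ 5 := by
  have h1 := (H.fixed_of_isEigen hw h.near_complex h.eigen h.normalized).1
  have h2 := H.norm_vec_le h1
  rwa [H.vec_coords _ h.normalized] at h2

theorem Eigenpair.sub_le {H : TwoLevel e d v j q lam lam' α β} (h : H.Eigenpair w f μ)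
    (h' : H.Eigenpair w' f' μ') (hw : ‖w - v‖ ≤ 300 * e ^ 11) (hw' : ‖w' - v‖ ≤ 300 * e ^ 11) :
    ‖f - f'‖ ≤ 240 / e ^ 10 * ‖w - w'‖ := by
  obtain ⟨h1, h2⟩ := H.fixed_of_isEigen hw h.near_complex h.eigen h.normalized
  obtain ⟨h3, h4⟩ := H.fixed_of_isEigen hw' h'.near_complex h'.eigen h'.normalized
  have h5 := H.fixed_sub_le hw hw' h1 h3 h2 h4
  have h6 := H.norm_vec_sub_le (H.coords (μ : ℂ) f) (H.coords (μ' : ℂ) f')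
  rw [H.vec_coords _ h.normalized, H.vec_coords _ h'.normalized] at h6
  calc ‖f - f'‖ ≤ 3 * (80 / e ^ 10 * ‖w - w'‖) := h6.trans (by gcongr)
    _ = 240 / e ^ 10 * ‖w - w'‖ := by ring

/-- For a normalized eigenvector the equation along the model eigenvector says that `μ - lam` is a
coordinate of the perturbation. This sharpens the a priori radius `e¹⁰/4` to order `e¹¹` and is the
source of the `ε¹¹` in the distance of the curves. -/
theorem Eigenpair.near_model {H : TwoLevel e d v j q lam lam' α β} (h : H.Eigenpair w f μ)
    (hw : ‖w - v‖ ≤ 300 * e ^ 11) : |μ - lam| ≤ 3002 * e ^ 11 := by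
  obtain ⟨h1, h2⟩ := H.fixed_of_isEigen hw h.near_complex h.eigen h.normalized
  have h3 := ((H.two_level_iff w μ f).1 ⟨by rw [conv_apply]; exact h.eigen j, by
    rw [conv_apply]; exact h.eigen (j - q)⟩).1
  rw [h.normalized, mul_one] at h3
  have h4 := H.residual_eq_perturb w (H.fixed_fst h2) (H.fixed_snd h2)
  rw [H.vec_coords _ h.normalized] at h4
  rw [← norm_ofReal_sub, ← h3, ← h4]
  calc _ ≤ 2 * (1501 * e ^ 11) := (H.norm_plusCoord_le _).trans (by
        gcongr
        exact H.norm_residual_le hw h1)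
    _ = 3002 * e ^ 11 := by ring

theorem plusCoord_toL2 (H : TwoLevel e d v j q lam lam' α β) (f : Seq 1) :
    H.plusCoord (toL2 f) = H.plusCoord f := by
  simp only [plusCoord, toL2_apply]

theorem Eigenpair.half_le_norm {H : TwoLevel e d v j q lam lam' α β} (h : H.Eigenpair w f μ) :
    1 / 2 ≤ ‖toL2 f‖ := by
  have h1 := H.norm_plusCoord_le (toL2 f)
  rw [H.plusCoord_toL2, h.normalized, norm_one] at h1
  linarith

/-- The eigenvalue near the model eigenvalue is unique and simple. -/
theorem Eigenpair.unique {H : TwoLevel e d v j q lam lam' α β} (h : H.Eigenpair w f μ)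
    (hw : ‖w - v‖ ≤ 300 * e ^ 11) {ν : ℝ} {g : Seq 2} (hν : |ν - lam| < e ^ 10 / 4)
    (hg : IsEigen d w ν g) (h0 : g ≠ 0) : ν = μ ∧ ∃ c : ℂ, g = c • toL2 f := by
  have hν' : ‖(ν : ℂ) - lam‖ ≤ e ^ 10 / 4 := by
    rw [norm_ofReal_sub]
    exact hν.le
  -- The competitor `g` is only in `ℓ²`, so it is normalized and compared with `f` as fixed points
  -- in `ℓ²`. Equality of the coordinates yields both the eigenvalue and the vector.
  have ha := H.plusCoord_ne_zero hw hν' hg h0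
  set a := H.plusCoord g with ha_def
  have h1 : IsEigen d w ν (a⁻¹ • g : Seq 2) := by
    rw [lp.coeFn_smul]
    exact hg.smul a⁻¹
  have h2 : H.plusCoord (a⁻¹ • g) = 1 := by
    have : H.plusCoord (a⁻¹ • g) = a⁻¹ * a := by
      rw [ha_def]
      simp only [plusCoord, lp.coeFn_smul, Pi.smul_apply, smul_eq_mul]
      ring
    rw [this, inv_mul_cancel₀ ha]
  have h3 : H.plusCoord (toL2 f) = 1 := (H.plusCoord_toL2 f).trans h.normalized
  have h4 : IsEigen d w μ (toL2 f) := h.eigen.toL2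
  obtain ⟨h5, h6⟩ := H.fixed_of_isEigen hw hν' h1 h2
  obtain ⟨h7, h8⟩ := H.fixed_of_isEigen hw h.near_complex h4 h3
  have h9 := H.fixed_unique hw h5 h7 h6 h8
  constructor
  · have := congrArg H.value h9
    rw [H.value_coords, H.value_coords] at this
    exact_mod_cast this
  · refine ⟨a, ?_⟩
    have := congrArg H.vec h9
    rw [H.vec_coords _ h2, H.vec_coords _ h3] at this
    rw [← this, smul_smul, mul_inv_cancel₀ ha, one_smul]

end

end TwoLevel

/-! ### Spectral projections -/

section

variable {e : ℝ} {t : Plane} {v : Seq 1} {j q : Lattice} {lam lam' : ℝ} {α β : ℂ}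
  {H : TwoLevel e (fun m => ‖momentum m t‖ ^ 2) v j q lam lam' α β} {w f : Seq 1} {μ : ℝ}
  {W : Plane → ℂ}

theorem eigenEquation_iff (hW : ∀ n, cellFourierCoeff W n = w n) (ν : ℝ) (g : Seq 2) :
    EigenEquation W t ν g ↔ IsEigen (fun m => ‖momentum m t‖ ^ 2) w ν g := by
  simp only [EigenEquation, IsEigen, hW]

theorem TwoLevel.Eigenpair.toL2_ne_zero (h : H.Eigenpair w f μ) : toL2 f ≠ 0 := by
  intro h0
  have := h.half_le_norm
  rw [h0, norm_zero] at this
  norm_num at this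

theorem TwoLevel.Eigenpair.isEigenvalue_iff (h : H.Eigenpair w f μ) (hw : ‖w - v‖ ≤ 300 * e ^ 11)
    (hW : ∀ n, cellFourierCoeff W n = w n) (ν : ℝ) :
    (|ν - lam| < e ^ 10 / 4 ∧ IsEigenvalue W t ν) ↔ ν = μ := by
  constructor
  · rintro ⟨hν, g, h0, hg⟩
    exact (h.unique hw hν ((eigenEquation_iff hW ν g).1 hg) h0).1
  · rintro rfl
    exact ⟨h.near, toL2 f, h.toL2_ne_zero, (eigenEquation_iff hW ν _).2 h.eigen.toL2⟩

theorem TwoLevel.Eigenpair.spectralSubspace_eq (h : H.Eigenpair w f μ)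
    (hw : ‖w - v‖ ≤ 300 * e ^ 11) (hW : ∀ n, cellFourierCoeff W n = w n) :
    spectralSubspace W t lam (e ^ 10 / 4) = ℂ ∙ toL2 f := by
  have h1 : Submodule.span ℂ {g | ∃ ν : ℝ, |ν - lam| < e ^ 10 / 4 ∧ EigenEquation W t ν g} =
      ℂ ∙ toL2 f := by
    refine le_antisymm (Submodule.span_le.2 ?_) (Submodule.span_mono ?_)
    · rintro g ⟨ν, hν, hg⟩
      rcases eq_or_ne g 0 with rfl | h0
      · exact zero_mem _
      · obtain ⟨-, c, rfl⟩ := h.unique hw hν ((eigenEquation_iff hW ν g).1 hg) h0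
        exact Submodule.smul_mem _ _ (Submodule.mem_span_singleton_self _)
    · rintro _ rfl
      exact ⟨μ, h.near, (eigenEquation_iff hW μ _).2 h.eigen.toL2⟩
  rw [spectralSubspace, h1]
  exact (Submodule.closed_of_finiteDimensional _).submodule_topologicalClosure_eq

theorem TwoLevel.Eigenpair.spectralProjection_eq (h : H.Eigenpair w f μ)
    (hw : ‖w - v‖ ≤ 300 * e ^ 11) (hW : ∀ n, cellFourierCoeff W n = w n) (i m : Lattice) :
    spectralProjection W t lam (e ^ 10 / 4) m i = lineProjection i f m := by
  have key : ∀ (K : Submodule ℂ (Seq 2)) [K.HasOrthogonalProjection], K = ℂ ∙ toL2 f →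
      K.starProjection (lp.single 2 i (1 : ℂ)) m = lineProjection i f m := by
    rintro K _ rfl
    exact starProjection_span i f m
  exact key _ (h.spectralSubspace_eq hw hW)

end

/-! ### Plane waves -/

theorem latticePoint_apply (n : Lattice) (i : Fin 2) : latticePoint n i = n i := rfl

theorem latticePoint_add (m n : Lattice) :
    latticePoint (m + n) = latticePoint m + latticePoint n := by
  ext i; simp [latticePoint]

theorem latticePoint_sub (m n : Lattice) :
    latticePoint (m - n) = latticePoint m - latticePoint n := by
  ext i; simp [latticePoint]

theorem latticePoint_neg (n : Lattice) : latticePoint (-n) = -latticePoint n := by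
  ext i; simp [latticePoint]

@[simp] theorem norm_planeWave (k x : Plane) : ‖planeWave k x‖ = 1 := by
  rw [planeWave, mul_comm, Complex.norm_exp_ofReal_mul_I]

theorem planeWave_add (k l x : Plane) : planeWave (k + l) x = planeWave k x * planeWave l x := by
  simp only [planeWave, inner_add_left, Complex.ofReal_add, mul_add, Complex.exp_add]

theorem planeWave_add_right (k x y : Plane) :
    planeWave k (x + y) = planeWave k x * planeWave k y := by
  simp only [planeWave, inner_add_right, Complex.ofReal_add, mul_add, Complex.exp_add]

theorem conj_planeWave (k x : Plane) : conj (planeWave k x) = planeWave (-k) x := by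
  simp only [planeWave, ← Complex.exp_conj, map_mul, Complex.conj_I, Complex.conj_ofReal,
    inner_neg_left, Complex.ofReal_neg]
  ring_nf

theorem continuous_planeWave (k : Plane) : Continuous (planeWave k) := by
  unfold planeWave
  fun_prop

theorem planeWave_period (n : Lattice) (i : Fin 2) :
    planeWave (latticePoint n) (EuclideanSpace.single i (2 * Real.pi)) = 1 := by
  rw [planeWave, EuclideanSpace.inner_single_right, Complex.exp_eq_one_iff]
  refine ⟨n i, ?_⟩
  simp only [latticePoint_apply, conj_trivial]
  push_cast
  ring

/-! ### Absolutely convergent trigonometric series -/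

/-- The sum of the trigonometric series with coefficients `c ∈ ℓ¹`. -/
def trigSeries (c : Seq 1) (x : Plane) : ℂ := ∑' n, c n * planeWave (latticePoint n) x

theorem summable_mul_planeWave (c : Seq 1) (k : Lattice → Plane) (x : Plane) :
    Summable fun n => c n * planeWave (k n) x :=
  .of_norm (by simpa using summable_norm c)

theorem continuous_trigSeries (c : Seq 1) : Continuous (trigSeries c) :=
  continuous_tsum (fun n => continuous_const.mul (continuous_planeWave _)) (summable_norm c)
    fun n x => by simp

theorem isPeriodic_trigSeries (c : Seq 1) : IsPeriodic (trigSeries c) := fun x i => by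
  simp only [trigSeries, planeWave_add_right, planeWave_period, mul_one]

theorem trigSeries_add (a b : Seq 1) (x : Plane) :
    trigSeries (a + b) x = trigSeries a x + trigSeries b x := by
  rw [trigSeries, trigSeries, trigSeries,
    ← (summable_mul_planeWave a _ x).tsum_add (summable_mul_planeWave b _ x)]
  simp [add_mul]

theorem trigSeries_smul (a : ℂ) (b : Seq 1) (x : Plane) :
    trigSeries (a • b) x = a * trigSeries b x := by
  rw [trigSeries, trigSeries, ← tsum_mul_left]
  simp [mul_assoc]

/-- The coefficients of the complex conjugate of a trigonometric series. -/
def reflect (c : Seq 1) : Seq 1 :=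
  ⟨fun n => conj (c (-n)), memℓp_one (by
    simp only [RCLike.norm_conj]
    exact (Equiv.neg Lattice).summable_iff.2 (summable_norm c))⟩

theorem reflect_apply (c : Seq 1) (n : Lattice) : reflect c n = conj (c (-n)) := rfl

theorem norm_reflect (c : Seq 1) : ‖reflect c‖ = ‖c‖ := by
  rw [norm_eq_tsum, norm_eq_tsum, ← (Equiv.neg Lattice).tsum_eq]
  simp [reflect_apply]

theorem reflect_sub (a b : Seq 1) : reflect (a - b) = reflect a - reflect b := by
  ext n
  simp [reflect_apply]

theorem conj_trigSeries (c : Seq 1) (x : Plane) :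
    conj (trigSeries c x) = trigSeries (reflect c) x := by
  rw [trigSeries, trigSeries, Complex.conj_tsum, ← (Equiv.neg Lattice).tsum_eq]
  simp [reflect_apply, conj_planeWave, latticePoint_neg]

theorem norm_trigSeries_le (c : Seq 1) (x : Plane) : ‖trigSeries c x‖ ≤ ‖c‖ := by
  rw [norm_eq_tsum, trigSeries]
  simpa using norm_tsum_le_tsum_norm (f := fun n => c n * planeWave (latticePoint n) x)
    (by simpa using summable_norm c)

/-- Evaluation of trigonometric series at a point. -/
def evalSeries (x : Plane) : Seq 1 →L[ℂ] ℂ :=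
  LinearMap.mkContinuous
    { toFun := fun c => trigSeries c x
      map_add' := fun a b => trigSeries_add a b x
      map_smul' := fun a b => trigSeries_smul a b x } 1
    fun c => (norm_trigSeries_le c x).trans_eq (one_mul _).symm

theorem evalSeries_apply (x : Plane) (c : Seq 1) : evalSeries x c = trigSeries c x := rfl

theorem trigSeries_shift (n : Lattice) (c : Seq 1) (x : Plane) :
    trigSeries (shift n c) x = planeWave (latticePoint n) x * trigSeries c x := by
  rw [trigSeries, trigSeries, ← tsum_mul_left, ← (Equiv.addRight n).tsum_eq]
  refine tsum_congr fun m => ?_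
  simp only [shift_apply, Equiv.coe_addRight, add_sub_cancel_right, latticePoint_add,
    planeWave_add]
  ring

theorem trigSeries_conv (a b : Seq 1) (x : Plane) :
    trigSeries (conv a b) x = trigSeries a x * trigSeries b x := by
  have h := (evalSeries x).map_tsum (summable_norm_conv a b).of_norm
  simp only [map_smul, evalSeries_apply, trigSeries_shift, smul_eq_mul, ← mul_assoc] at h
  exact h.trans tsum_mul_right

/-! ### Fourier coefficients -/

/-- The one-dimensional wave `exp (i k y)`. -/
def wave (k : ℤ) (y : ℝ) : ℂ := Complex.exp (Complex.I * (k * y : ℝ))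

theorem continuous_wave (k : ℤ) : Continuous (wave k) := by
  unfold wave
  fun_prop

@[simp] theorem norm_wave (k : ℤ) (y : ℝ) : ‖wave k y‖ = 1 := by
  rw [wave, mul_comm, Complex.norm_exp_ofReal_mul_I]

theorem planeWave_latticePoint (n : Lattice) (x y : ℝ) :
    planeWave (latticePoint n) !₂[x, y] = wave (n 0) x * wave (n 1) y := by
  rw [planeWave, wave, wave, ← Complex.exp_add, ← mul_add, ← Complex.ofReal_add]
  congr 3
  simp [PiLp.inner_apply, Fin.sum_univ_two, latticePoint]
  ring

theorem integral_wave (k : ℤ) :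
    ∫ y in (0 : ℝ)..(2 * Real.pi), wave k y = if k = 0 then 2 * Real.pi else 0 := by
  split_ifs with h
  · simp [wave, h]
  · have hc : Complex.I * k ≠ 0 := mul_ne_zero Complex.I_ne_zero (by exact_mod_cast h)
    have h1 := integral_exp_mul_complex (a := 0) (b := 2 * Real.pi) hc
    have h2 : ∀ y : ℝ, wave k y = Complex.exp (Complex.I * k * y) := fun y => by
      rw [wave]
      push_cast
      rw [mul_assoc]
    simp only [h2, h1]
    have h3 : Complex.exp (Complex.I * k * ((2 * Real.pi : ℝ) : ℂ)) = 1 := by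
      rw [Complex.exp_eq_one_iff]
      exact ⟨k, by push_cast; ring⟩
    rw [h3]
    simp

theorem continuous_cell_integrand {W : Plane → ℂ} (hW : Continuous W) (n : Lattice) :
    Continuous (Function.uncurry fun x y : ℝ =>
      W !₂[x, y] * planeWave (-latticePoint n) !₂[x, y]) := by
  have h : Continuous fun z : ℝ × ℝ => (!₂[z.1, z.2] : Plane) := by fun_prop
  exact (hW.comp h).mul ((continuous_planeWave _).comp h)

theorem cellFourierCoeff_sub {W W' : Plane → ℂ} (hW : Continuous W) (hW' : Continuous W')
    (n : Lattice) :
    cellFourierCoeff (W - W') n = cellFourierCoeff W n - cellFourierCoeff W' n := by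
  have h1 := continuous_cell_integrand hW n
  have h2 := continuous_cell_integrand hW' n
  rw [cellFourierCoeff, cellFourierCoeff, cellFourierCoeff, ← mul_sub,
    ← intervalIntegral.integral_sub
      ((intervalIntegral.continuous_parametric_intervalIntegral_of_continuous' h1 _ _).intervalIntegrable _ _)
      ((intervalIntegral.continuous_parametric_intervalIntegral_of_continuous' h2 _ _).intervalIntegrable _ _)]
  congr 1
  refine intervalIntegral.integral_congr fun x _ => ?_
  simp only [Pi.sub_apply, sub_mul]
  exact intervalIntegral.integral_sub
    ((h1.comp (by fun_prop : Continuous fun y : ℝ => (x, y))).intervalIntegrable _ _)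
    ((h2.comp (by fun_prop : Continuous fun y : ℝ => (x, y))).intervalIntegrable _ _)

theorem integral_tsum_mul {c : Lattice → ℂ} {F : Lattice → ℝ → ℂ} {B : ℝ}
    (hc : Summable fun n => ‖c n‖) (hF : ∀ n, Continuous (F n)) (hB : ∀ n x, ‖F n x‖ ≤ B) :
    ∫ x in (0 : ℝ)..(2 * Real.pi), ∑' n, c n * F n x =
      ∑' n, c n * ∫ x in (0 : ℝ)..(2 * Real.pi), F n x := by
  have h1 : ∀ n x, ‖c n * F n x‖ ≤ ‖c n‖ * B := fun n x => by
    rw [norm_mul]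
    exact mul_le_mul_of_nonneg_left (hB n x) (norm_nonneg _)
  have h2 := intervalIntegral.hasSum_integral_of_dominated_convergence
    (μ := MeasureTheory.volume) (a := 0) (b := 2 * Real.pi) (F := fun n x => c n * F n x)
    (f := fun x => ∑' n, c n * F n x) (fun n _ => ‖c n‖ * B)
    (fun n => (continuous_const.mul (hF n)).aestronglyMeasurable)
    (fun n => .of_forall fun x _ => h1 n x) (.of_forall fun _ _ => hc.mul_right B)
    intervalIntegrable_const
    (.of_forall fun x _ => (Summable.of_norm_bounded (hc.mul_right B) fun n => h1 n x).hasSum)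
  rw [← h2.tsum_eq]
  simp

/-- Termwise integration in each variable, then orthogonality of the exponentials. It lets the
iteration pass between functions and coefficient sequences. -/
theorem cellFourierCoeff_trigSeries (c : Seq 1) (m : Lattice) :
    cellFourierCoeff (trigSeries c) m = c m := by
  have hpi : (Real.pi : ℂ) ≠ 0 := Complex.ofReal_ne_zero.2 Real.pi_ne_zero
  have h1 : ∀ x y : ℝ, trigSeries c !₂[x, y] * planeWave (-latticePoint m) !₂[x, y] =
      ∑' n, c n * (wave (n 0 - m 0) x * wave (n 1 - m 1) y) := by
    intro x y
    rw [trigSeries, ← tsum_mul_right]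
    refine tsum_congr fun n => ?_
    rw [mul_assoc, ← planeWave_add, ← sub_eq_add_neg, ← latticePoint_sub, planeWave_latticePoint]
    rfl
  have h2 : ∀ x : ℝ, ∫ y in (0 : ℝ)..(2 * Real.pi),
        trigSeries c !₂[x, y] * planeWave (-latticePoint m) !₂[x, y] =
      ∑' n, c n * (wave (n 0 - m 0) x * ∫ y in (0 : ℝ)..(2 * Real.pi), wave (n 1 - m 1) y) := by
    intro x
    simp only [h1]
    rw [integral_tsum_mul (F := fun n y => wave (n 0 - m 0) x * wave (n 1 - m 1) y) (B := 1)
      (summable_norm c) (fun n => continuous_const.mul (continuous_wave _)) (fun n y => by simp)]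
    simp
  have h3 : ∀ k : ℤ, ‖∫ y in (0 : ℝ)..(2 * Real.pi), wave k y‖ ≤ 2 * Real.pi := fun k => by
    rw [integral_wave]
    split_ifs
    · rw [Complex.norm_real, Real.norm_of_nonneg (by positivity)]
    · simpa using Real.pi_pos.le
  rw [cellFourierCoeff]
  simp only [h2]
  rw [integral_tsum_mul (F := fun n x => wave (n 0 - m 0) x *
      ∫ y in (0 : ℝ)..(2 * Real.pi), wave (n 1 - m 1) y) (B := 2 * Real.pi) (summable_norm c)
    (fun n => (continuous_wave _).mul continuous_const) (fun n y => by simpa using h3 _)]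
  simp only [intervalIntegral.integral_mul_const, integral_wave]
  rw [tsum_eq_single m]
  · simp only [sub_self, if_true]
    push_cast
    field_simp
  · intro n hn
    by_cases h0 : n 0 = m 0
    · have h4 : n 1 - m 1 ≠ 0 := fun h => hn (by
        ext i
        fin_cases i
        · exact h0
        · exact sub_eq_zero.1 h)
      simp [h4]
    · simp [sub_ne_zero.2 h0]

/-- The coefficients of a trigonometric polynomial. -/
def polyCoeff (v : Lattice →₀ ℂ) : Seq 1 :=
  ⟨fun n => v n, memℓp_one (summable_of_hasFiniteSupport (v.hasFiniteSupport.subset fun n hn => by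
    simpa using hn))⟩

@[simp] theorem polyCoeff_apply (v : Lattice →₀ ℂ) (n : Lattice) : polyCoeff v n = v n := rfl

theorem trigSeries_polyCoeff (v : Lattice →₀ ℂ) : trigSeries (polyCoeff v) = trigPoly v := by
  ext x
  rw [trigSeries, trigPoly]
  refine tsum_eq_sum (f := fun n => polyCoeff v n * planeWave (latticePoint n) x) fun n hn => ?_
  simp only [polyCoeff_apply]
  rw [Finsupp.notMem_support_iff.1 hn, zero_mul]

theorem starNorm_trigSeries (c : Seq 1) : starNorm (trigSeries c) = ENNReal.ofReal ‖c‖ := by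
  simp only [starNorm, cellFourierCoeff_trigSeries]
  rw [norm_eq_tsum, ENNReal.ofReal_tsum_of_nonneg (fun _ => norm_nonneg _) (summable_norm c)]
  simp only [ofReal_norm]

/-- If trigonometric series converge in the norm `‖·‖_*` to a continuous function, then the
coefficients converge in `ℓ¹` to the Fourier coefficients of the limit. -/
theorem tendsto_coeff_of_starNorm {c : ℕ → Seq 1} {W : Plane → ℂ} (hW : Continuous W)
    (h : Tendsto (fun m => starNorm (trigSeries (c m) - W)) atTop (𝓝 0)) :
    ∃ w : Seq 1, (∀ n, cellFourierCoeff W n = w n) ∧ Tendsto c atTop (𝓝 w) := by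
  have h1 : ∀ m, starNorm (trigSeries (c m) - W) = ∑' n, ‖c m n - cellFourierCoeff W n‖ₑ := by
    intro m
    simp only [starNorm, cellFourierCoeff_sub (continuous_trigSeries (c m)) hW,
      cellFourierCoeff_trigSeries]
  -- A single term at finite distance from `W` already shows that the Fourier coefficients of `W`
  -- are summable.
  obtain ⟨M, hM⟩ := (h.eventually_lt_const (zero_lt_one)).exists
  have hs : Summable fun n => ‖c M n - cellFourierCoeff W n‖ := by
    rw [h1] at hM
    have h2 : ∑' n, ‖c M n - cellFourierCoeff W n‖ₑ ≠ ⊤ := (hM.trans ENNReal.one_lt_top).ne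
    have h3 := ENNReal.summable_toReal h2
    simpa using h3
  let w : Seq 1 := c M - ⟨_, memℓp_one hs⟩
  have hw : ∀ n, cellFourierCoeff W n = w n := fun n => by
    have : w n = c M n - (c M n - cellFourierCoeff W n) := rfl
    rw [this, sub_sub_cancel]
  refine ⟨w, hw, ?_⟩
  rw [tendsto_iff_norm_sub_tendsto_zero]
  have h4 : ∀ m, starNorm (trigSeries (c m) - W) = ENNReal.ofReal ‖c m - w‖ := by
    intro m
    rw [h1, norm_eq_tsum, ENNReal.ofReal_tsum_of_nonneg (fun _ => norm_nonneg _)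
      (summable_norm _)]
    simp only [ofReal_norm, hw, lp.coeFn_sub, Pi.sub_apply]
  simp only [h4] at h
  have h5 := (ENNReal.tendsto_toReal ENNReal.zero_ne_top).comp h
  simpa [Function.comp_def] using h5

theorem trigSeries_sub (a b : Seq 1) (x : Plane) :
    trigSeries (a - b) x = trigSeries a x - trigSeries b x :=
  (evalSeries x).map_sub a b

/-! ### The iteration for the potential -/

/-- The coefficients of the admissible real potentials near `v`. -/
def admissible (v : Seq 1) (e : ℝ) : Set (Seq 1) :=
  {w | (∀ n, w (-n) = conj (w n)) ∧ ‖w - v‖ ≤ 300 * e ^ 11}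

theorem isClosed_admissible (v : Seq 1) (e : ℝ) : IsClosed (admissible v e) := by
  have hc : ∀ n : Lattice, Continuous fun w : Seq 1 => w n := fun n =>
    (lp.evalCLM ℂ (fun _ : Lattice => ℂ) 1 n).continuous
  refine IsClosed.and ?_ (isClosed_le (by fun_prop) continuous_const)
  simp only [Set.ofPred_forall]
  exact isClosed_iInter fun n => isClosed_eq (hc _) (Complex.continuous_conj.comp (hc n))

/-- The coefficients of `|φ|²`, where `φ` has the coefficients `z`. -/
def density (z : Seq 1) : Seq 1 := conv z (reflect z)

theorem trigSeries_density (z : Seq 1) (x : Plane) :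
    trigSeries (density z) x = ((‖trigSeries z x‖ ^ 2 : ℝ) : ℂ) := by
  rw [density, trigSeries_conv, ← conj_trigSeries, Complex.mul_conj']
  push_cast
  rfl

/-- `|φ|²` is real, and the coefficients of a series are determined by its sum. -/
theorem reflect_density (z : Seq 1) : reflect (density z) = density z := by
  ext n
  rw [← cellFourierCoeff_trigSeries, ← cellFourierCoeff_trigSeries]
  congr 1
  ext x
  rw [← conj_trigSeries, trigSeries_density, Complex.conj_ofReal]

theorem density_neg (z : Seq 1) (n : Lattice) : density z (-n) = conj (density z n) := by
  rw [← Complex.conj_conj (density z (-n)), ← reflect_apply, reflect_density]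

theorem norm_density_le {z : Seq 1} {B : ℝ} (hz : ‖z‖ ≤ B) : ‖density z‖ ≤ B ^ 2 := by
  refine (norm_conv_le _ _).trans ?_
  rw [norm_reflect, ← sq]
  gcongr

theorem norm_density_sub_le {z z' : Seq 1} {B : ℝ} (hz : ‖z‖ ≤ B) (hz' : ‖z'‖ ≤ B) :
    ‖density z - density z'‖ ≤ 2 * B * ‖z - z'‖ := by
  have h1 : density z - density z' = conv z (reflect (z - z')) + conv (z - z') (reflect z') := by
    rw [density, density, reflect_sub, conv_sub_right, conv_sub_left]
    abel
  rw [h1]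
  calc _ ≤ ‖z‖ * ‖z - z'‖ + ‖z - z'‖ * ‖z'‖ := norm_add_le_of_le
        ((norm_conv_le _ _).trans_eq (by rw [norm_reflect]))
        ((norm_conv_le _ _).trans_eq (by rw [norm_reflect]))
    _ ≤ B * ‖z - z'‖ + ‖z - z'‖ * B := by gcongr
    _ = 2 * B * ‖z - z'‖ := by ring

namespace TwoLevel

variable {e : ℝ} {d : Lattice → ℝ} {v : Seq 1} {j q : Lattice} {lam lam' : ℝ} {α β : ℂ}

/-- The column `j` of the spectral projection for the potential with coefficients `w`. -/
def column (H : TwoLevel e d v j q lam lam' α β) (w : Seq 1) : Seq 1 :=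
  open Classical in
  if h : ∃ f μ, H.Eigenpair w f μ then lineProjection j h.choose else 0

theorem exists_column (H : TwoLevel e d v j q lam lam' α β) {w : Seq 1}
    (hw : w ∈ admissible v e) : ∃ f μ, H.Eigenpair w f μ ∧ H.column w = lineProjection j f := by
  have h := H.exists_eigenpair hw.2 hw.1
  obtain ⟨μ, hμ⟩ := h.choose_spec
  exact ⟨h.choose, μ, hμ, dif_pos h⟩

theorem norm_column_le (H : TwoLevel e d v j q lam lam' α β) {w : Seq 1}
    (hw : w ∈ admissible v e) : ‖H.column w‖ ≤ 10 := by
  obtain ⟨f, μ, h, hf⟩ := H.exists_column hw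
  rw [hf]
  exact norm_lineProjection_le j h.half_le_norm (h.norm_le hw.2)

theorem norm_column_sub_le (H : TwoLevel e d v j q lam lam' α β) {w w' : Seq 1}
    (hw : w ∈ admissible v e) (hw' : w' ∈ admissible v e) :
    ‖H.column w - H.column w'‖ ≤ 10 ^ 6 / e ^ 10 * ‖w - w'‖ := by
  obtain ⟨f, μ, h, hf⟩ := H.exists_column hw
  obtain ⟨f', μ', h', hf'⟩ := H.exists_column hw'
  have he := H.pos
  rw [hf, hf']
  calc _ ≤ 4040 * (240 / e ^ 10 * ‖w - w'‖) := by
        refine (norm_lineProjection_sub_le j h.half_le_norm (h.norm_le hw.2) h'.half_le_norm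
          (h'.norm_le hw'.2)).trans ?_
        gcongr
        exact h.sub_le h' hw.2 hw'.2
    _ = 969600 / e ^ 10 * ‖w - w'‖ := by ring
    _ ≤ _ := by gcongr; norm_num

/-- The coefficients of the potential `V + σ |u_W|²`; `κ = σ |A|²`. -/
def next (H : TwoLevel e d v j q lam lam' α β) (κ : ℝ) (w : Seq 1) : Seq 1 :=
  v + (κ : ℂ) • density (H.column w)

/-- The column has norm at most `10`, so the new potential is within `100 e¹¹` of `v`; the radius
`300 e¹¹` leaves room. -/
theorem next_mem (H : TwoLevel e d v j q lam lam' α β) {κ : ℝ} (hκ : |κ| < e ^ 11)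
    (hv : ∀ n, v (-n) = conj (v n)) {w : Seq 1} (hw : w ∈ admissible v e) :
    H.next κ w ∈ admissible v e := by
  have he := H.pos
  constructor
  · intro n
    simp only [next, lp.coeFn_add, lp.coeFn_smul, Pi.add_apply, Pi.smul_apply, smul_eq_mul,
      map_add, map_mul, Complex.conj_ofReal, hv, density_neg]
  · rw [next, add_sub_cancel_left, norm_smul, Complex.norm_real, Real.norm_eq_abs]
    have h1 := norm_density_le (H.norm_column_le hw)
    have h2 := mul_le_mul hκ.le h1 (norm_nonneg _) (by positivity)
    linarith [pow_pos he 11]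

/-- The coupling `e¹¹` beats the Lipschitz constant `10⁶/e¹⁰` of the column by one factor `e`, which
`e < 10⁻⁹` makes small enough for the numerical constants. -/
theorem norm_next_sub_le (H : TwoLevel e d v j q lam lam' α β) {κ : ℝ} (hκ : |κ| < e ^ 11)
    {w w' : Seq 1} (hw : w ∈ admissible v e) (hw' : w' ∈ admissible v e) :
    ‖H.next κ w - H.next κ w'‖ ≤ 1 / 2 * ‖w - w'‖ := by
  have he := H.pos
  have hs := H.small
  rw [next, next, add_sub_add_left_eq_sub, ← smul_sub, norm_smul, Complex.norm_real,
    Real.norm_eq_abs]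
  calc _ ≤ e ^ 11 * (2 * 10 * (10 ^ 6 / e ^ 10 * ‖w - w'‖)) := by
        gcongr
        refine (norm_density_sub_le (H.norm_column_le hw) (H.norm_column_le hw')).trans ?_
        gcongr
        exact H.norm_column_sub_le hw hw'
    _ = 20 * 10 ^ 6 * e * ‖w - w'‖ := by field_simp; ring
    _ ≤ 1 / 2 * ‖w - w'‖ := by gcongr; linarith

theorem exists_next_fixed (H : TwoLevel e d v j q lam lam' α β) {κ : ℝ} (hκ : |κ| < e ^ 11)
    (hv : ∀ n, v (-n) = conj (v n)) :
    ∃ w ∈ admissible v e, H.next κ w = w ∧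
      Tendsto (fun m => (H.next κ)^[m] v) atTop (𝓝 w) := by
  have hv' : v ∈ admissible v e := ⟨hv, by
    rw [sub_self, norm_zero]
    have := H.pos
    positivity⟩
  have hmaps : Set.MapsTo (H.next κ) (admissible v e) (admissible v e) :=
    fun w hw => H.next_mem hκ hv hw
  have hc : ContractingWith (1 / 2) (hmaps.restrict (H.next κ) _ _) := by
    refine ⟨by norm_num, LipschitzWith.of_dist_le_mul fun w w' => ?_⟩
    have h1 := H.norm_next_sub_le hκ w.2 w'.2
    rw [Subtype.dist_eq, Subtype.dist_eq, dist_eq_norm, dist_eq_norm]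
    simpa using h1
  obtain ⟨w, hw, hfix, hlim, -⟩ :=
    hc.exists_fixedPoint' (isClosed_admissible v e).isComplete hmaps hv' (edist_ne_top _ _)
  exact ⟨w, hw, hfix, hlim⟩

theorem iterate_next_mem (H : TwoLevel e d v j q lam lam' α β) {κ : ℝ} (hκ : |κ| < e ^ 11)
    (hv : ∀ n, v (-n) = conj (v n)) (m : ℕ) : (H.next κ)^[m] v ∈ admissible v e := by
  induction m with
  | zero => exact ⟨hv, by
      rw [Function.iterate_zero_apply, sub_self, norm_zero]
      have := H.pos
      positivity⟩
  | succ m ih =>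
    rw [Function.iterate_succ_apply']
    exact H.next_mem hκ hv ih

end TwoLevel

/-! ### Resonant states -/

section

variable {ε : ℝ} {t : Plane} {v : Lattice →₀ ℂ} {j q : Lattice} {s : ℤˣ} {lam' : ℝ} {α β : ℂ}

theorem tsum_planeWave_momentum (z : Seq 1) (t x : Plane) :
    ∑' m, z m * planeWave (momentum m t) x = planeWave t x * trigSeries z x := by
  rw [trigSeries, ← tsum_mul_left]
  refine tsum_congr fun m => ?_
  rw [momentum, planeWave_add]
  ring

theorem TwoLevel.Eigenpair.resonantWave_eq
    {H : TwoLevel ε (fun m => ‖momentum m t‖ ^ 2) (polyCoeff v) j q (modelEigenvalue s v q j t)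
      lam' α β}
    {w f : Seq 1} {μ : ℝ} (h : H.Eigenpair w f μ)
    (hw : ‖w - polyCoeff v‖ ≤ 300 * ε ^ 11) {W : Plane → ℂ} (hW : ∀ n, cellFourierCoeff W n = w n)
    (A : ℂ) (x : Plane) : resonantWave v A q ε s j t W x =
      A * (planeWave t x * trigSeries (lineProjection j f) x) := by
  rw [resonantWave, ← tsum_planeWave_momentum]
  congr 1
  refine tsum_congr fun m => ?_
  rw [h.spectralProjection_eq hw hW]

theorem ofReal_norm_wave_sq (A : ℂ) (z : Seq 1) (t x : Plane) (σ : ℝ) :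
    ((σ * ‖A * (planeWave t x * trigSeries z x)‖ ^ 2 : ℝ) : ℂ) =
      trigSeries (((σ * ‖A‖ ^ 2 : ℝ) : ℂ) • density z) x := by
  rw [trigSeries_smul, trigSeries_density, norm_mul, norm_mul, norm_planeWave]
  push_cast
  ring

/-- By induction every iterate is admissible, so its resonant wave is given by the rank-one
projection; the factor `exp (i ⟨t, x⟩)` has modulus one and drops out of `|u|²`. -/
theorem potentialSeq_eq
    (H : TwoLevel ε (fun m => ‖momentum m t‖ ^ 2) (polyCoeff v) j q (modelEigenvalue s v q j t)
      lam' α β)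
    {σ : ℝ} {A : ℂ} (hσ : |σ * ‖A‖ ^ 2| < ε ^ 11)
    (hv : ∀ n, v (-n) = conj (v n)) (m : ℕ) :
    potentialSeq v σ A q ε s j t m =
      trigSeries ((H.next (σ * ‖A‖ ^ 2))^[m] (polyCoeff v)) := by
  induction m with
  | zero => exact (trigSeries_polyCoeff v).symm
  | succ m ih =>
    ext x
    have hm := H.iterate_next_mem hσ hv m
    obtain ⟨f, μ, h, hf⟩ := H.exists_column hm
    rw [potentialSeq, ih]
    beta_reduce
    rw [h.resonantWave_eq hm.2 (cellFourierCoeff_trigSeries _) A x,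
      ofReal_norm_wave_sq, Function.iterate_succ_apply', TwoLevel.next, trigSeries_add,
      trigSeries_polyCoeff, hf]

/-- The limit of the successive approximations exists and determines the resonant state. -/
theorem exists_resonantState
    (H : TwoLevel ε (fun m => ‖momentum m t‖ ^ 2) (polyCoeff v) j q (modelEigenvalue s v q j t)
      lam' α β)
    {σ : ℝ} {A : ℂ} (hσ : |σ * ‖A‖ ^ 2| < ε ^ 11)
    (hv : ∀ n, v (-n) = conj (v n)) :
    ∃ (w f : Seq 1) (μ : ℝ), w ∈ admissible (polyCoeff v) ε ∧ H.Eigenpair w f μ ∧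
      w = polyCoeff v + ((σ * ‖A‖ ^ 2 : ℝ) : ℂ) • density (lineProjection j f) ∧
      ∀ u lam, IsResonantState v σ A q ε s j t u lam ↔
        lam = μ ∧ u = fun x => A * (planeWave t x * trigSeries (lineProjection j f) x) := by
  obtain ⟨w, hw, hfix, hlim⟩ := H.exists_next_fixed hσ hv
  obtain ⟨f, μ, h, hf⟩ := H.exists_column hw
  refine ⟨w, f, μ, hw, h, ?_, fun u lam => ⟨?_, ?_⟩⟩
  · rw [← hf]
    exact hfix.symm
  · rintro ⟨W, hWc, -, hWlim, hnear, heig, rfl⟩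
    simp only [potentialSeq_eq H hσ hv] at hWlim
    obtain ⟨w', hw', hlim'⟩ := tendsto_coeff_of_starNorm hWc hWlim
    -- Any limit `W` has the Fourier coefficients `w`, and the eigenvalue and the resonant wave
    -- depend on `W` only through these.
    obtain rfl := tendsto_nhds_unique hlim hlim'
    exact ⟨(h.isEigenvalue_iff hw.2 hw' lam).1 ⟨hnear, heig⟩,
      funext fun x => h.resonantWave_eq hw.2 hw' A x⟩
  · rintro ⟨rfl, rfl⟩
    have hW := cellFourierCoeff_trigSeries w
    obtain ⟨h1, h2⟩ := (h.isEigenvalue_iff hw.2 hW lam).2 rfl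
    refine ⟨trigSeries w, continuous_trigSeries w, isPeriodic_trigSeries w, ?_, h1, h2,
      funext fun x => (h.resonantWave_eq hw.2 hW A x).symm⟩
    have h3 : ∀ m, starNorm (potentialSeq v σ A q ε s j t m - trigSeries w) =
        ENNReal.ofReal ‖(H.next (σ * ‖A‖ ^ 2))^[m] (polyCoeff v) - w‖ := by
      intro m
      rw [← starNorm_trigSeries, potentialSeq_eq H hσ hv]
      congr 1
      ext x
      exact (trigSeries_sub _ _ x).symm
    simp only [h3]
    simpa using ENNReal.tendsto_ofReal (tendsto_iff_norm_sub_tendsto_zero.1 hlim)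

end

/-! ### Derivatives of plane waves -/

/-- The function `y ↦ exp (i y)` on the real line. -/
def unitWave (y : ℝ) : ℂ := Complex.exp (Complex.I * y)

theorem hasDerivAt_unitWave (y : ℝ) : HasDerivAt unitWave (Complex.I * unitWave y) y := by
  have h1 : HasDerivAt (fun y : ℝ => Complex.I * (y : ℂ)) (Complex.I * 1) y :=
    (Complex.ofRealCLM.hasDerivAt (x := y)).const_mul Complex.I
  rw [mul_one] at h1
  rw [mul_comm]
  exact h1.cexp

theorem contDiff_unitWave {n : WithTop ℕ∞} : ContDiff ℝ n unitWave :=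
  (contDiff_const.mul Complex.ofRealCLM.contDiff).cexp

theorem iteratedDeriv_unitWave (n : ℕ) :
    iteratedDeriv n unitWave = fun y => Complex.I ^ n * unitWave y := by
  induction n with
  | zero => simp
  | succ n ih =>
    rw [iteratedDeriv_succ, ih]
    ext y
    rw [((hasDerivAt_unitWave y).const_mul (Complex.I ^ n)).deriv]
    ring

theorem planeWave_eq_comp (k : Plane) : planeWave k = unitWave ∘ innerSL ℝ k := rfl

theorem contDiff_planeWave (k : Plane) {n : WithTop ℕ∞} : ContDiff ℝ n (planeWave k) :=
  contDiff_unitWave.comp (innerSL ℝ k).contDiff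

/-- A plane wave is a function of one real variable composed with a linear functional. -/
theorem iteratedFDeriv_planeWave (k x : Plane) (n : ℕ) (m : Fin n → Plane) :
    iteratedFDeriv ℝ n (planeWave k) x m =
      ((∏ i, inner ℝ k (m i) : ℝ) : ℂ) * (Complex.I ^ n * planeWave k x) := by
  rw [planeWave_eq_comp,
    (innerSL ℝ k).iteratedFDeriv_comp_right (n := n) contDiff_unitWave x le_rfl,
    ContinuousMultilinearMap.compContinuousLinearMap_apply,
    iteratedFDeriv_apply_eq_iteratedDeriv_mul_prod, iteratedDeriv_unitWave]
  simp

theorem norm_iteratedFDeriv_planeWave_le (k x : Plane) (n : ℕ) :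
    ‖iteratedFDeriv ℝ n (planeWave k) x‖ ≤ ‖k‖ ^ n := by
  refine ContinuousMultilinearMap.opNorm_le_bound (by positivity) fun m => ?_
  rw [iteratedFDeriv_planeWave, norm_mul, norm_mul, norm_pow, Complex.norm_I, one_pow,
    norm_planeWave, mul_one, mul_one, Complex.norm_real, norm_prod]
  calc ∏ i, ‖inner ℝ k (m i)‖ ≤ ∏ i, ‖k‖ * ‖m i‖ :=
        Finset.prod_le_prod (fun _ _ => norm_nonneg _) fun i _ => norm_inner_le_norm k (m i)
    _ = ‖k‖ ^ n * ∏ i, ‖m i‖ := by simp [Finset.prod_mul_distrib]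

/-! ### Smooth series of plane waves -/

section

variable {b : Lattice → ℂ} {P : Lattice → Plane}

theorem summable_mul_pow (h0 : Summable fun m => ‖b m‖)
    (h2 : Summable fun m => ‖P m‖ ^ 2 * ‖b m‖) {n : ℕ} (hn : n ≤ 2) :
    Summable fun m => ‖P m‖ ^ n * ‖b m‖ := by
  refine Summable.of_nonneg_of_le (fun m => by positivity) (fun m => ?_) (h0.add h2)
  rw [← one_add_mul]
  gcongr
  interval_cases n <;> nlinarith [norm_nonneg (P m), sq_nonneg (‖P m‖ - 1)]

theorem norm_iteratedFDeriv_smul_planeWave_le (n : ℕ) (m : Lattice) (x : Plane) :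
    ‖iteratedFDeriv ℝ n (fun x => b m • planeWave (P m) x) x‖ ≤ ‖P m‖ ^ n * ‖b m‖ := by
  rw [iteratedFDeriv_const_smul_apply' (contDiff_planeWave _).contDiffAt, norm_smul, mul_comm]
  gcongr
  exact norm_iteratedFDeriv_planeWave_le _ _ _

theorem contDiff_tsum_planeWave (h0 : Summable fun m => ‖b m‖)
    (h2 : Summable fun m => ‖P m‖ ^ 2 * ‖b m‖) :
    ContDiff ℝ 2 fun x => ∑' m, b m • planeWave (P m) x := by
  refine contDiff_tsum (N := 2) (v := fun n m => ‖P m‖ ^ n * ‖b m‖)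
    (fun m => (contDiff_planeWave (P m)).const_smul (b m))
    (fun n hn => summable_mul_pow h0 h2 (by exact_mod_cast hn))
    (fun n m x _ => norm_iteratedFDeriv_smul_planeWave_le n m x)

/-- Second derivatives are taken termwise, which the weight `‖P m‖²` permits; over an orthonormal
basis the squared inner products add up to `‖P m‖²`. -/
theorem laplacian_tsum_planeWave (h0 : Summable fun m => ‖b m‖)
    (h2 : Summable fun m => ‖P m‖ ^ 2 * ‖b m‖) (x : Plane) :
    Laplacian.laplacian (fun x => ∑' m, b m • planeWave (P m) x) x =
      ∑' m, -(((‖P m‖ ^ 2 : ℝ) : ℂ) * (b m * planeWave (P m) x)) := by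
  have h1 := iteratedFDeriv_tsum_apply (𝕜 := ℝ) (N := 2) (v := fun n m => ‖P m‖ ^ n * ‖b m‖)
    (fun m => (contDiff_planeWave (P m)).const_smul (b m))
    (fun n hn => summable_mul_pow h0 h2 (by exact_mod_cast hn))
    (fun n m x _ => norm_iteratedFDeriv_smul_planeWave_le n m x) (k := 2) le_rfl x
  have hs : Summable fun m => iteratedFDeriv ℝ 2 (fun x => b m • planeWave (P m) x) x :=
    .of_norm_bounded h2 fun m => norm_iteratedFDeriv_smul_planeWave_le 2 m x
  have h3 : ∀ m (y : Plane), iteratedFDeriv ℝ 2 (fun x => b m • planeWave (P m) x) x ![y, y] =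
      -(((inner ℝ (P m) y ^ 2 : ℝ) : ℂ) * (b m * planeWave (P m) x)) := fun m y => by
    rw [iteratedFDeriv_const_smul_apply' (contDiff_planeWave _).contDiffAt,
      smul_apply, iteratedFDeriv_planeWave, Fin.prod_univ_two]
    simp only [Matrix.cons_val_zero, Matrix.cons_val_one, Complex.I_sq, smul_eq_mul]
    push_cast
    ring
  have h4 : ∀ y : Plane, Summable fun m =>
      -(((inner ℝ (P m) y ^ 2 : ℝ) : ℂ) * (b m * planeWave (P m) x)) := fun y => by
    simp only [← h3]
    exact (ContinuousMultilinearMap.hasSum_eval hs.hasSum ![y, y]).summable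
  rw [InnerProductSpace.laplacian_eq_iteratedFDeriv_orthonormalBasis _
    (EuclideanSpace.basisFun (Fin 2) ℝ)]
  simp only [h1, ContinuousMultilinearMap.tsum_eval hs, h3]
  rw [Fin.sum_univ_two, ← (h4 _).tsum_add (h4 _)]
  refine tsum_congr fun m => ?_
  rw [EuclideanSpace.real_norm_sq_eq, Fin.sum_univ_two]
  simp only [EuclideanSpace.basisFun_apply, EuclideanSpace.inner_single_right, conj_trivial,
    one_mul]
  push_cast
  ring

end

/-! ### The nonlinear equation -/

theorem wave_quasiperiodic (A : ℂ) (c : Seq 1) (t x : Plane) (i : Fin 2) :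
    A * (planeWave t (x + EuclideanSpace.single i (2 * Real.pi)) *
      trigSeries c (x + EuclideanSpace.single i (2 * Real.pi))) =
    Complex.exp (2 * Real.pi * Complex.I * (t i : ℝ)) * (A * (planeWave t x * trigSeries c x)) := by
  rw [isPeriodic_trigSeries, planeWave_add_right]
  have h1 : planeWave t (EuclideanSpace.single i (2 * Real.pi)) =
      Complex.exp (2 * Real.pi * Complex.I * (t i : ℝ)) := by
    rw [planeWave, EuclideanSpace.inner_single_right]
    congr 1
    simp only [conj_trivial]
    push_cast
    ring
  rw [h1]
  ring

/-- An eigenvector of `H₀(t) + W`, where `W = V + σ |u|²`, is a solution of the nonlinear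
equation. -/
theorem solvesGPE_of_isEigen {v : Lattice →₀ ℂ} {σ : ℝ} {A : ℂ} {t : Plane} {w z : Seq 1} {μ : ℝ}
    (hz : IsEigen (fun m => ‖momentum m t‖ ^ 2) w μ z)
    (hw : w = polyCoeff v + ((σ * ‖A‖ ^ 2 : ℝ) : ℂ) • density z) :
    SolvesGPE v σ t (fun x => A * (planeWave t x * trigSeries z x)) μ := by
  obtain ⟨b, hb⟩ : ∃ b : Seq 1, b = A • z := ⟨_, rfl⟩
  have hbz : IsEigen (fun m => ‖momentum m t‖ ^ 2) w μ b := by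
    rw [hb, lp.coeFn_smul]
    exact hz.smul A
  have hu : (fun x => A * (planeWave t x * trigSeries z x)) =
      fun x => ∑' m, b m • planeWave (momentum m t) x := by
    ext x
    simp only [smul_eq_mul]
    rw [tsum_planeWave_momentum, hb, trigSeries_smul]
    ring
  -- Regularity from the equation itself: `|P_m|² b_m` is a coefficient of `μ b - w * b`, which is
  -- in `ℓ¹`, so the series may be differentiated twice.
  have hd : ∀ m, ((‖momentum m t‖ ^ 2 : ℝ) : ℂ) * b m = ((μ : ℂ) • b - conv w b) m := fun m => by
    have := hbz m
    rw [← conv_apply] at this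
    beta_reduce at this
    rw [lp.coeFn_sub, lp.coeFn_smul, Pi.sub_apply, Pi.smul_apply, smul_eq_mul]
    linear_combination this
  have h0 := summable_norm b
  have h2 : Summable fun m => ‖momentum m t‖ ^ 2 * ‖b m‖ := by
    refine (summable_norm ((μ : ℂ) • b - conv w b)).congr fun m => ?_
    rw [← hd, norm_mul, Complex.norm_real, Real.norm_of_nonneg (by positivity)]
  refine ⟨?_, fun x => ?_, fun x i => wave_quasiperiodic A z t x i, fun x i => ?_⟩
  · rw [hu]
    exact contDiff_tsum_planeWave h0 h2
  · have h3 : trigSeries w x = trigPoly v x +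
        (σ * ‖A * (planeWave t x * trigSeries z x)‖ ^ 2 : ℝ) := by
      rw [hw, trigSeries_add, trigSeries_polyCoeff, ofReal_norm_wave_sq]
    have h4 : Laplacian.laplacian (fun x => A * (planeWave t x * trigSeries z x)) x =
        -(planeWave t x * trigSeries ((μ : ℂ) • b - conv w b) x) := by
      rw [hu, laplacian_tsum_planeWave h0 h2, tsum_neg, ← tsum_planeWave_momentum]
      simp only [← mul_assoc, hd]
    have h5 : trigSeries b x = A * trigSeries z x := by rw [hb, trigSeries_smul]
    rw [h4, trigSeries_sub, trigSeries_smul, trigSeries_conv, h3, h5]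
    ring
  · have h3 : (fun y => A * (planeWave t (y + EuclideanSpace.single i (2 * Real.pi)) *
        trigSeries z (y + EuclideanSpace.single i (2 * Real.pi)))) =
        fun y => Complex.exp (2 * Real.pi * Complex.I * (t i : ℝ)) •
          (A * (planeWave t y * trigSeries z y)) :=
      funext fun y => wave_quasiperiodic A z t y i
    have h4 : DifferentiableAt ℝ (fun x => A * (planeWave t x * trigSeries z x)) x := by
      rw [hu]
      exact (contDiff_tsum_planeWave h0 h2).differentiable (by norm_num) x
    rw [← fderiv_comp_add_right (f := fun x => A * (planeWave t x * trigSeries z x)), h3,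
      fderiv_fun_const_smul h4]
    rfl

/-! ### The two-level model -/

theorem modelEigenvalue_mul (s : ℤˣ) (v : Lattice →₀ ℂ) (q j : Lattice) (t : Plane) :
    (modelEigenvalue s v q j t - ‖momentum j t‖ ^ 2) *
      (modelEigenvalue s v q j t - ‖momentum (j - q) t‖ ^ 2) = ‖v q‖ ^ 2 := by
  rw [modelEigenvalue]
  generalize ‖momentum j t‖ ^ 2 = a
  generalize ‖momentum (j - q) t‖ ^ 2 = b
  have h1 : √(4 * ‖v q‖ ^ 2 + (a - b) ^ 2) ^ 2 = 4 * ‖v q‖ ^ 2 + (a - b) ^ 2 :=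
    Real.sq_sqrt (by positivity)
  have h2 : ((s : ℤ) : ℝ) ^ 2 = 1 := by
    rcases Int.units_eq_one_or s with rfl | rfl <;> simp
  linear_combination (((s : ℤ) : ℝ) ^ 2 / 4) * h1 + (‖v q‖ ^ 2 + (a - b) ^ 2 / 4) * h2

/-- The model eigenvalue is within `|v_q|` of one of the two unperturbed levels. -/
theorem modelEigenvalue_near (s : ℤˣ) (v : Lattice →₀ ℂ) (q j : Lattice) (t : Plane) :
    |modelEigenvalue s v q j t - ‖momentum j t‖ ^ 2| ≤ ‖v q‖ ∨
      |modelEigenvalue s v q j t - ‖momentum (j - q) t‖ ^ 2| ≤ ‖v q‖ := by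
  by_contra! h
  have h1 := congrArg abs (modelEigenvalue_mul s v q j t)
  rw [abs_mul, abs_of_nonneg (sq_nonneg ‖v q‖), sq ‖v q‖] at h1
  exact absurd h1 (mul_lt_mul'' h.1 h.2 (norm_nonneg _) (norm_nonneg _)).ne'

/-- A unit eigenvector of a Hermitian `2 × 2` matrix with nonzero off-diagonal elements. -/
theorem exists_unit_eigenvector {a b lam : ℝ} {c : ℂ} (hc : c ≠ 0)
    (h : (lam - a) * (lam - b) = ‖c‖ ^ 2) :
    ∃ α β : ℂ, ‖α‖ ^ 2 + ‖β‖ ^ 2 = 1 ∧ (a : ℂ) * α + c * β = lam * α ∧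
      conj c * α + (b : ℂ) * β = lam * β := by
  have hN : 0 < ‖c‖ ^ 2 + (lam - a) ^ 2 := by
    have := norm_pos_iff.2 hc
    positivity
  set N := √(‖c‖ ^ 2 + (lam - a) ^ 2) with hN_def
  have hN0 : 0 < N := Real.sqrt_pos.2 hN
  have hN2 : N ^ 2 = ‖c‖ ^ 2 + (lam - a) ^ 2 := Real.sq_sqrt hN.le
  have hNC : (N : ℂ) ≠ 0 := Complex.ofReal_ne_zero.2 hN0.ne'
  have hC : ((lam : ℂ) - a) * (lam - b) = conj c * c := by
    rw [Complex.conj_mul']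
    exact_mod_cast h
  -- The vector `(c, lam - a)` solves the first equation, and the second is the characteristic
  -- equation; `c ≠ 0` allows the normalization.
  refine ⟨c / N, ((lam - a : ℝ) : ℂ) / N, ?_, ?_, ?_⟩
  · rw [norm_div, norm_div, Complex.norm_real, Complex.norm_real, Real.norm_of_nonneg hN0.le,
      Real.norm_eq_abs, div_pow, div_pow, sq_abs, ← add_div, ← hN2]
    field_simp
  · push_cast
    field_simp
    ring
  · push_cast
    field_simp
    linear_combination -hC

/-! ### Geometry of the resonant set -/

theorem momentum_add (m : Lattice) (t h : Plane) : momentum m (t + h) = momentum m t + h := by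
  rw [momentum, momentum, add_assoc]

theorem momentum_sub_index (j q : Lattice) (t : Plane) :
    momentum (j - q) t = momentum j t - latticePoint q := by
  rw [momentum, momentum, latticePoint_sub]
  abel

/-- Squared lengths stay separated under a small translation. -/
theorem separated_translate {ε k : ℝ} (hε : 0 < ε) (hε1 : ε < 1 / 10 ^ 9) (hk : 100 < k)
    {X Y h : Plane} (hY : ‖Y‖ ≤ 2 * k) (hsep : 2 * ε ^ 6 < |‖Y‖ ^ 2 - ‖X‖ ^ 2|)
    (hh : ‖h‖ < k⁻¹ * ε ^ 7) : ε ^ 6 + ε ^ 9 ≤ |‖X + h‖ ^ 2 - ‖Y + h‖ ^ 2| := by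
  have hk0 : 0 < k := by linarith
  have h69 : ε ^ 9 ≤ ε ^ 6 * (1 / 1000) := by
    have : ε ^ 3 ≤ 1 / 1000 := by
      have : ε ^ 3 ≤ ε := by
        simpa using pow_le_pow_of_le_one hε.le (by linarith) (by norm_num : 1 ≤ 3)
      linarith
    calc ε ^ 9 = ε ^ 6 * ε ^ 3 := by ring
      _ ≤ _ := by gcongr
  have h67 : ε ^ 7 ≤ ε ^ 6 * (1 / 1000) := by
    calc ε ^ 7 = ε ^ 6 * ε := by ring
      _ ≤ _ := by gcongr; linarith
  have h6 : 0 < ε ^ 6 := by positivity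
  have h61 : ε ^ 6 ≤ 1 / 1000 := by
    have : ε ^ 6 ≤ ε := by
      simpa using pow_le_pow_of_le_one hε.le (by linarith) (by norm_num : 1 ≤ 6)
    linarith
  have hkh : ‖h‖ * k ≤ ε ^ 7 := by
    calc ‖h‖ * k ≤ k⁻¹ * ε ^ 7 * k := by gcongr
      _ = ε ^ 7 := by field_simp
  have hh1 : ‖h‖ ≤ 1 := by nlinarith [norm_nonneg h]
  have hid : ‖X + h‖ ^ 2 - ‖Y + h‖ ^ 2 = (‖X‖ ^ 2 - ‖Y‖ ^ 2) + 2 * inner ℝ (X - Y) h := by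
    rw [norm_add_sq_real, norm_add_sq_real, inner_sub_left]
    ring
  have hin : |2 * inner ℝ (X - Y) h| ≤ 2 * ((‖X‖ + ‖Y‖) * ‖h‖) := by
    rw [abs_mul, abs_two]
    gcongr
    exact (abs_real_inner_le_norm _ _).trans (by gcongr; exact norm_sub_le _ _)
  have htri : |‖X‖ ^ 2 - ‖Y‖ ^ 2| - |2 * inner ℝ (X - Y) h| ≤ |‖X + h‖ ^ 2 - ‖Y + h‖ ^ 2| := by
    rw [hid]
    exact abs_sub_abs_le_abs_add _ _
  refine le_trans ?_ htri
  -- If `‖X‖ ≤ 4k`, the translation changes the difference of squares by at most `12ε⁷`, well below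
  -- the margin `ε⁶`. If `‖X‖ > 4k`, the difference is large whatever the hypothesis `hsep` says.
  rcases le_or_gt ‖X‖ (4 * k) with hX | hX
  · rw [abs_sub_comm] at hsep
    have h1 : (‖X‖ + ‖Y‖) * ‖h‖ ≤ 6 * ε ^ 7 := by
      calc (‖X‖ + ‖Y‖) * ‖h‖ ≤ (4 * k + 2 * k) * ‖h‖ := by gcongr
        _ = 6 * (‖h‖ * k) := by ring
        _ ≤ 6 * ε ^ 7 := by gcongr
    linarith
  · have h1 : (‖X‖ + ‖Y‖) * (‖X‖ - ‖Y‖) ≤ |‖X‖ ^ 2 - ‖Y‖ ^ 2| := by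
      rw [← sq_sub_sq]
      exact le_abs_self _
    have h2 : 1 ≤ (‖X‖ + ‖Y‖) * (‖X‖ - ‖Y‖ - 2 * ‖h‖) := by
      have h3 : 1 ≤ ‖X‖ + ‖Y‖ := by linarith [norm_nonneg Y]
      have h4 : 1 ≤ ‖X‖ - ‖Y‖ - 2 * ‖h‖ := by linarith
      nlinarith
    nlinarith

/-- Near the resonant set the two resonant levels are separated from all others. -/
theorem exists_twoLevel {v : Lattice →₀ ℂ} {q j : Lattice} {ε k : ℝ} {t t₀ : Plane} (s : ℤˣ)
    (hv0 : v 0 = 0) (hv : ∀ n, v (-n) = conj (v n)) (hε : 0 < ε) (hε1 : ε < 1 / 10 ^ 9)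
    (hnorm : ‖polyCoeff v‖ ≤ ε ^ 9) (hq : ε ^ 10 < ‖v q‖) (hk : 100 < k)
    (hqk : ‖latticePoint q‖ ≤ k) (h0 : IsResonant q k ε j t₀) (ht : dist t t₀ < k⁻¹ * ε ^ 7) :
    ∃ (lam' : ℝ) (α β : ℂ), TwoLevel ε (fun m => ‖momentum m t‖ ^ 2) (polyCoeff v) j q
      (modelEigenvalue s v q j t) lam' α β := by
  have hvq : v q ≠ 0 := norm_pos_iff.1 ((pow_pos hε 10).trans hq)
  have hvq9 : ‖v q‖ ≤ ε ^ 9 := (norm_apply_le (polyCoeff v) q).trans hnorm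
  obtain ⟨α, β, hu, h1, h2⟩ := exists_unit_eigenvector hvq (modelEigenvalue_mul s v q j t)
  have hY1 : ‖momentum j t₀‖ ≤ 2 * k := by linarith [h0.mem_layer.1]
  have hY2 : ‖momentum (j - q) t₀‖ ≤ 2 * k := by
    rw [momentum_sub_index]
    linarith [h0.mem_layer.1, norm_sub_le (momentum j t₀) (latticePoint q)]
  refine ⟨‖momentum j t‖ ^ 2 + ‖momentum (j - q) t‖ ^ 2 - modelEigenvalue s v q j t, α, β,
    hε, hε1, ?_, hv0, hv q, hnorm, hu, h1, h2, by ring, ?_, fun m hm hm' => ?_⟩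
  · rintro rfl
    exact hvq hv0
  -- The two model eigenvalues differ by the square root of the discriminant, which is at least
  -- `2|v_q|`.
  · have h3 : ‖momentum j t‖ ^ 2 + ‖momentum (j - q) t‖ ^ 2 - modelEigenvalue s v q j t -
        modelEigenvalue s v q j t = -(((s : ℤ) : ℝ) *
          √(4 * ‖v q‖ ^ 2 + (‖momentum j t‖ ^ 2 - ‖momentum (j - q) t‖ ^ 2) ^ 2)) := by
      rw [modelEigenvalue]
      ring
    have h4 : |((s : ℤ) : ℝ)| = 1 := by
      rcases Int.units_eq_one_or s with rfl | rfl <;> simp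
    rw [h3, abs_neg, abs_mul, h4, one_mul, abs_of_nonneg (Real.sqrt_nonneg _)]
    refine Real.le_sqrt_of_sq_le ?_
    have h5 : (2 * ε ^ 10) ^ 2 ≤ (2 * ‖v q‖) ^ 2 := by gcongr
    nlinarith [sq_nonneg (‖momentum j t‖ ^ 2 - ‖momentum (j - q) t‖ ^ 2)]
  · have hadd : t = t₀ + (t - t₀) := by abel
    rw [dist_eq_norm] at ht
    obtain ⟨hs1, hs2⟩ := h0.separated m hm hm'
    have h3 := separated_translate hε hε1 hk hY1 hs1 ht
    have h4 := separated_translate hε hε1 hk hY2 hs2 ht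
    rw [← momentum_add, ← momentum_add, ← hadd] at h3 h4
    -- The extra `ε⁹` in `h3` and `h4` pays for the distance, at most `|v_q| ≤ ε⁹`, between the
    -- model eigenvalue and the nearer resonant level.
    rcases modelEigenvalue_near s v q j t with h5 | h5
    · have := abs_sub_le (‖momentum m t‖ ^ 2) (modelEigenvalue s v q j t) (‖momentum j t‖ ^ 2)
      linarith
    · have := abs_sub_le (‖momentum m t‖ ^ 2) (modelEigenvalue s v q j t)
        (‖momentum (j - q) t‖ ^ 2)
      linarith

/-! ### Displacement orthogonal to `q` and distance to the model curve. -/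

/-- The lattice vector `q`, rotated by a right angle. -/
def perp (q : Lattice) : Plane := !₂[-(q 1 : ℝ), (q 0 : ℝ)]

theorem inner_perp_latticePoint (q : Lattice) : inner ℝ (latticePoint q) (perp q) = 0 := by
  simp [perp, latticePoint, PiLp.inner_apply, Fin.sum_univ_two]
  ring

theorem norm_perp_sq (q : Lattice) : ‖perp q‖ ^ 2 = ‖latticePoint q‖ ^ 2 := by
  simp [perp, latticePoint, EuclideanSpace.real_norm_sq_eq, Fin.sum_univ_two]
  ring

theorem norm_perp (q : Lattice) : ‖perp q‖ = ‖latticePoint q‖ :=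
  (pow_left_inj₀ (norm_nonneg _) (norm_nonneg _) two_ne_zero).1 (norm_perp_sq q)

theorem inner_sq_add_inner_perp_sq (P : Plane) (q : Lattice) :
    inner ℝ P (latticePoint q) ^ 2 + inner ℝ P (perp q) ^ 2 = ‖P‖ ^ 2 * ‖latticePoint q‖ ^ 2 := by
  simp [perp, latticePoint, EuclideanSpace.real_norm_sq_eq, PiLp.inner_apply, Fin.sum_univ_two]
  ring

theorem one_le_norm_latticePoint {q : Lattice} (hq : q ≠ 0) : 1 ≤ ‖latticePoint q‖ := by
  have h1 : ∃ i, q i ≠ 0 := by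
    by_contra! h
    exact hq (funext h)
  obtain ⟨i, hi⟩ := h1
  have h2 : (1 : ℝ) ≤ |(q i : ℝ)| := by exact_mod_cast Int.one_le_abs hi
  exact h2.trans (PiLp.norm_apply_le (latticePoint q) i)

/-- Along the direction orthogonal to `q` the model eigenvalue is a quadratic polynomial. -/
theorem modelEigenvalue_perp (s : ℤˣ) (v : Lattice →₀ ℂ) (q j : Lattice) (t : Plane) (τ : ℝ) :
    modelEigenvalue s v q j (t + τ • perp q) = modelEigenvalue s v q j t +
      (2 * τ * inner ℝ (momentum j t) (perp q) + τ ^ 2 * ‖latticePoint q‖ ^ 2) := by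
  have h1 : ‖τ • perp q‖ ^ 2 = τ ^ 2 * ‖latticePoint q‖ ^ 2 := by
    rw [norm_smul, mul_pow, norm_perp, Real.norm_eq_abs, sq_abs]
  have h2 : ‖momentum j (t + τ • perp q)‖ ^ 2 = ‖momentum j t‖ ^ 2 +
      (2 * τ * inner ℝ (momentum j t) (perp q) + τ ^ 2 * ‖latticePoint q‖ ^ 2) := by
    rw [momentum_add, norm_add_sq_real, inner_smul_right, h1]
    ring
  have h3 : ‖momentum (j - q) (t + τ • perp q)‖ ^ 2 = ‖momentum (j - q) t‖ ^ 2 +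
      (2 * τ * inner ℝ (momentum j t) (perp q) + τ ^ 2 * ‖latticePoint q‖ ^ 2) := by
    rw [momentum_add, norm_add_sq_real, inner_smul_right, h1, momentum_sub_index, inner_sub_left,
      inner_perp_latticePoint]
    ring
  simp only [modelEigenvalue, h2, h3, add_sub_add_right_eq_sub]
  ring

/-- Near the resonant set the momentum is almost orthogonal to `q`. -/
theorem le_abs_inner_perp {q j : Lattice} {ε k : ℝ} {t t₀ : Plane} (hε1 : ε ≤ 1) (hq : q ≠ 0)
    (hk : 100 < k) (hqk : 100 * ‖latticePoint q‖ ≤ k) (h0 : IsResonant q k ε j t₀)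
    (ht : dist t t₀ ≤ 1) :
    k * ‖latticePoint q‖ / 2 ≤ |inner ℝ (momentum j t) (perp q)| := by
  obtain ⟨h1, h2⟩ := h0.mem_layer
  have hQ := one_le_norm_latticePoint hq
  have hpyth := inner_sq_add_inner_perp_sq (momentum j t₀) q
  rw [norm_sub_sq_real, abs_lt] at h2
  rw [h1] at hpyth
  set Q := ‖latticePoint q‖
  set a := inner ℝ (momentum j t₀) (latticePoint q)
  set b := inner ℝ (momentum j t₀) (perp q)
  -- The layer condition reads `|2a - Q²| < ε`, so the component of the momentum along `q` stays
  -- bounded while its length is `k`. By Pythagoras nearly all of the momentum is along `perp q`.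
  have ha : |a| ≤ Q ^ 2 := by
    rw [abs_le]
    constructor <;> nlinarith
  have ha2 : a ^ 2 ≤ (Q ^ 2) ^ 2 := sq_le_sq' (by linarith [(abs_le.1 ha).1]) (abs_le.1 ha).2
  have hQ2 : (Q ^ 2) ^ 2 ≤ (k * Q / 10) ^ 2 := by
    have : Q ^ 2 ≤ k * Q / 10 := by nlinarith
    gcongr
  have hb : 0.9 * (k * Q) ≤ |b| := by
    refine abs_le_of_sq_le_sq' ?_ (abs_nonneg b) |>.2
    rw [sq_abs]
    nlinarith [sq_nonneg (k * Q)]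
  have hsplit : inner ℝ (momentum j t) (perp q) = b + inner ℝ (t - t₀) (perp q) := by
    rw [← inner_add_left, ← momentum_add]
    congr 2
    abel
  have hsmall : |inner ℝ (t - t₀) (perp q)| ≤ 1 * Q := by
    refine (abs_real_inner_le_norm _ _).trans ?_
    rw [norm_perp, ← dist_eq_norm]
    gcongr
  have h3 := abs_sub_abs_le_abs_add b (inner ℝ (t - t₀) (perp q))
  rw [hsplit]
  nlinarith

/-- Intermediate values between `τ = ±|η|/B`: there the linear term is `±2|η|` and the quadratic one
lies in `[0, |η|]`, so `η` is enclosed. The sign of `B` is arbitrary, hence unordered intervals. -/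
theorem exists_quadratic_eq {B c η : ℝ} (hB : B ≠ 0) (hc : 0 ≤ c) (hη : |η| * c ≤ B ^ 2) :
    ∃ τ, |τ| ≤ |η| / |B| ∧ 2 * τ * B + τ ^ 2 * c = η := by
  have hcont : ContinuousOn (fun τ : ℝ => 2 * τ * B + τ ^ 2 * c)
      (Set.uIcc (-(|η| / B)) (|η| / B)) := by fun_prop
  have h1 : (|η| / B) ^ 2 * c ≤ |η| := by
    rw [div_pow, div_mul_eq_mul_div, div_le_iff₀ (by positivity)]
    calc |η| ^ 2 * c = |η| * (|η| * c) := by ring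
      _ ≤ |η| * B ^ 2 := by gcongr
  have h2 : 2 * (|η| / B) * B = 2 * |η| := by field_simp
  have h3 : 0 ≤ (|η| / B) ^ 2 * c := by positivity
  have hmem : η ∈ Set.uIcc (2 * -(|η| / B) * B + (-(|η| / B)) ^ 2 * c)
      (2 * (|η| / B) * B + (|η| / B) ^ 2 * c) := by
    rw [Set.mem_uIcc]
    left
    rw [neg_sq, mul_neg, neg_mul, h2]
    constructor <;> linarith [neg_abs_le η, le_abs_self η, abs_nonneg η]
  obtain ⟨τ, hτ, hτ'⟩ := intermediate_value_uIcc hcont hmem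
  refine ⟨τ, ?_, hτ'⟩
  rw [show |η| / |B| = |(|η| / B)| by rw [abs_div, abs_abs]]
  rcases Set.mem_uIcc.1 hτ with h | h
  · exact abs_le.2 ⟨by linarith [le_abs_self (|η| / B)], h.2.trans (le_abs_self _)⟩
  · exact abs_le.2 ⟨by linarith [neg_abs_le (|η| / B)], by linarith [neg_abs_le (|η| / B)]⟩

/-- If `lam₀` is close to the model eigenvalue at `t`, then `t` is close to the model curve. -/
theorem exists_mem_modelCurve {v : Lattice →₀ ℂ} {q j : Lattice} {ε k lam₀ : ℝ} {t t₀ : Plane}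
    (s : ℤˣ) (hε : 0 < ε) (hε1 : ε < 1 / 10 ^ 9) (hvq : ‖v q‖ ≤ 1) (hq : q ≠ 0) (hk : 100 < k)
    (hqk : 100 * ‖latticePoint q‖ ≤ k) (h0 : IsResonant q k ε j t₀)
    (ht : dist t t₀ < k⁻¹ * ε ^ 7) (hlam : 0 < lam₀)
    (hnear : |lam₀ - modelEigenvalue s v q j t| ≤ 3002 * ε ^ 11) :
    ∃ t' ∈ modelCurve v q ε k s j lam₀,
      dist t t' < 30000 * ε ^ 11 * lam₀ ^ (-(1 / 2) : ℝ) := by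
  have hk0 : 0 < k := by linarith
  have hQ := one_le_norm_latticePoint hq
  have h11 : ε ^ 11 ≤ ε := by
    simpa using pow_le_pow_of_le_one hε.le (by linarith) (by norm_num : 1 ≤ 11)
  have ht1 : dist t t₀ ≤ 1 := by
    refine ht.le.trans ?_
    have h1 : k⁻¹ ≤ 1 := inv_le_one_of_one_le₀ (by linarith)
    have h2 : ε ^ 7 ≤ 1 := pow_le_one₀ hε.le (by linarith)
    calc k⁻¹ * ε ^ 7 ≤ 1 * 1 := by gcongr
      _ = 1 := one_mul 1
  have hB := le_abs_inner_perp (by linarith) hq hk hqk h0 ht1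
  set Q := ‖latticePoint q‖ with hQ_def
  set B := inner ℝ (momentum j t) (perp q) with hB_def
  set η := lam₀ - modelEigenvalue s v q j t with hη_def
  have hB0 : 0 < |B| := (by positivity : 0 < k * Q / 2).trans_le hB
  have hη1 : |η| ≤ 1 := by linarith
  have hηQ : |η| * Q ^ 2 ≤ B ^ 2 := by
    rw [← sq_abs B]
    calc |η| * Q ^ 2 ≤ 1 * Q ^ 2 := by gcongr
      _ ≤ (k * Q / 2) ^ 2 := by
        rw [one_mul]
        gcongr
        nlinarith
      _ ≤ |B| ^ 2 := by gcongr
  obtain ⟨τ, hτ, hτ'⟩ := exists_quadratic_eq (abs_pos.1 hB0) (sq_nonneg Q) hηQ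
  have hdist : dist t (t + τ • perp q) ≤ 6004 * ε ^ 11 / k := by
    rw [dist_self_add_right, norm_smul, norm_perp, Real.norm_eq_abs]
    calc |τ| * Q ≤ 3002 * ε ^ 11 / (k * Q / 2) * Q := by
          gcongr
          refine hτ.trans ?_
          gcongr
      _ = 6004 * ε ^ 11 / k := by field_simp; norm_num
  refine ⟨t + τ • perp q, ⟨⟨t₀, h0, ?_⟩, ?_⟩, ?_⟩
  -- The displacement is smaller than the original radius, so the new point stays in the
  -- neighbourhood of twice that radius, with the same centre and index.
  · have h1 : 6004 * ε ^ 11 / k < k⁻¹ * ε ^ 7 := by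
      rw [div_eq_inv_mul]
      gcongr
      have h2 : ε ^ 4 ≤ ε := by
        simpa using pow_le_pow_of_le_one hε.le (by linarith) (by norm_num : 1 ≤ 4)
      calc 6004 * ε ^ 11 = ε ^ 7 * (6004 * ε ^ 4) := by ring
        _ < ε ^ 7 * 1 := by gcongr; linarith
        _ = ε ^ 7 := mul_one _
    have h2 := dist_triangle (t + τ • perp q) t t₀
    rw [dist_comm (t + τ • perp q) t] at h2
    linarith
  · rw [modelEigenvalue_perp, hτ', hη_def]
    ring
  · have hmom : ‖momentum j t‖ ≤ k + 1 := by
      have h1 : momentum j t = momentum j t₀ + (t - t₀) := by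
        rw [← momentum_add]
        congr 1
        abel
      rw [h1]
      exact norm_add_le_of_le h0.mem_layer.1.le (dist_eq_norm t t₀ ▸ ht1)
    have hmom' : ‖momentum (j - q) t‖ ≤ 2 * k := by
      rw [momentum_sub_index]
      linarith [norm_sub_le (momentum j t) (latticePoint q)]
    -- The model eigenvalue is within `|v_q|` of a level of size at most `(2k)²`, which bounds
    -- `lam₀` in terms of `k`.
    have hlam2 : lam₀ ≤ (4 * k) ^ 2 := by
      have h1 := (abs_le.1 hη1).2
      have h2 : ‖momentum j t‖ ^ 2 ≤ (2 * k) ^ 2 := by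
        gcongr
        linarith
      have h3 : ‖momentum (j - q) t‖ ^ 2 ≤ (2 * k) ^ 2 := by gcongr
      rcases modelEigenvalue_near s v q j t with h4 | h4 <;>
      · have h5 := (abs_le.1 h4).2
        nlinarith
    have hsqrt : √lam₀ ≤ 4 * k := by
      rw [← Real.sqrt_sq (by positivity : 0 ≤ 4 * k)]
      exact Real.sqrt_le_sqrt hlam2
    have hs0 : 0 < √lam₀ := Real.sqrt_pos.2 hlam
    rw [Real.rpow_neg hlam.le, ← Real.sqrt_eq_rpow]
    calc dist t (t + τ • perp q) ≤ 6004 * ε ^ 11 / k := hdist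
      _ = 24016 * ε ^ 11 * (4 * k)⁻¹ := by field_simp; norm_num
      _ ≤ 24016 * ε ^ 11 * (√lam₀)⁻¹ := by gcongr
      _ < 30000 * ε ^ 11 * (√lam₀)⁻¹ := by gcongr; norm_num

end GrossPitaevskii

end
-- Assembly.
open GrossPitaevskii in
theorem mainTheorem6 :
    ∃ ε₀ C : ℝ, 0 < ε₀ ∧ 0 < C ∧
      ∀ v : Lattice →₀ ℂ, v 0 = 0 → (∀ n, v (-n) = conj (v n)) →
        ∀ ε : ℝ, 0 < ε → ε < ε₀ → starNorm (trigPoly v) < ENNReal.ofReal (ε ^ 9) →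
          ∃ k₁ lam₁ : ℝ, 0 < k₁ ∧ 0 < lam₁ ∧
            ∀ q : Lattice, ε ^ 10 < ‖v q‖ →
              ∀ (s : ℤˣ) (σ : ℝ) (A : ℂ), |σ| * ‖A‖ ^ 2 < ε ^ 11 →
                ∀ k : ℝ, k₁ < k → ∀ j : Lattice,
                  -- `λ(t)` is well defined and belongs to a solution of the nonlinear equation
                  (∀ t : Plane, NearResonant q k ε (k⁻¹ * ε ^ 7) j t →
                    (∃! p : (Plane → ℂ) × ℝ, IsResonantState v σ A q ε s j t p.1 p.2) ∧
                    ∀ (u : Plane → ℂ) (lam : ℝ), IsResonantState v σ A q ε s j t u lam →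
                      SolvesGPE v σ t u lam) ∧
                  -- the curve `λ(t) = lam₀` is close to the model curve
                  ∀ lam₀ : ℝ, lam₁ < lam₀ →
                    ∀ t ∈ isoenergeticCurve v σ A q ε k s j lam₀,
                      ∃ t' ∈ modelCurve v q ε k s j lam₀,
                        dist t t' < C * ε ^ 11 * lam₀ ^ (-(1 / 2) : ℝ) := by
  -- The sum over the support makes `k₁` at least `100|q|` for every `q` with `v_q ≠ 0`
  -- simultaneously, so it depends on `V` alone. The value `1` for the energy threshold serves only
  -- to make `lam₀` positive.
  refine ⟨1 / 10 ^ 9, 30000, by norm_num, by norm_num, fun v hv0 hv ε hε hε1 hstar =>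
    ⟨100 * (1 + ∑ n ∈ v.support, ‖latticePoint n‖), 1, by positivity, one_pos,
      fun q hq s σ A hσ k hk j => ?_⟩⟩
  rw [← trigSeries_polyCoeff, starNorm_trigSeries,
    ENNReal.ofReal_lt_ofReal_iff (by positivity)] at hstar
  have hvq : v q ≠ 0 := norm_pos_iff.1 ((pow_pos hε 10).trans hq)
  have hq0 : q ≠ 0 := by
    rintro rfl
    exact hvq hv0
  have hvq1 : ‖v q‖ ≤ 1 := (norm_apply_le (polyCoeff v) q).trans
    (hstar.le.trans (pow_le_one₀ hε.le (by linarith)))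
  have hsum : ‖latticePoint q‖ ≤ ∑ n ∈ v.support, ‖latticePoint n‖ :=
    Finset.single_le_sum (f := fun n => ‖latticePoint n‖) (fun _ _ => norm_nonneg _)
      (Finsupp.mem_support_iff.2 hvq)
  have hQ := norm_nonneg (latticePoint q)
  have hk100 : 100 < k := by linarith
  have hqk : 100 * ‖latticePoint q‖ ≤ k := by linarith
  have hσ' : |σ * ‖A‖ ^ 2| < ε ^ 11 := by
    rwa [abs_mul, abs_of_nonneg (by positivity : 0 ≤ ‖A‖ ^ 2)]
  constructor
  · rintro t ⟨t₀, h0, ht⟩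
    obtain ⟨lam', α, β, H⟩ := exists_twoLevel s hv0 hv hε hε1 hstar.le hq hk100 (by linarith) h0 ht
    obtain ⟨w, f, μ, -, h, hweq, hiff⟩ := exists_resonantState H hσ' hv
    refine ⟨⟨(_, μ), (hiff _ _).2 ⟨rfl, rfl⟩, fun p hp => ?_⟩, fun u lam hu => ?_⟩
    · obtain ⟨h1, h2⟩ := (hiff _ _).1 hp
      exact Prod.ext h2 h1
    · obtain ⟨rfl, rfl⟩ := (hiff _ _).1 hu
      -- The column of the projection is a scalar multiple of the eigenvector `f`, and `hweq` is the
      -- self-consistency of the limit potential.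
      refine solvesGPE_of_isEigen (w := w) ?_ hweq
      rw [lineProjection, lp.coeFn_smul]
      exact h.eigen.smul _
  · rintro lam₀ hlam t ⟨⟨t₀, h0, ht⟩, u, hu⟩
    obtain ⟨lam', α, β, H⟩ := exists_twoLevel s hv0 hv hε hε1 hstar.le hq hk100 (by linarith) h0 ht
    obtain ⟨w, f, μ, hw, h, -, hiff⟩ := exists_resonantState H hσ' hv
    obtain ⟨rfl, -⟩ := (hiff _ _).1 hu
    exact exists_mem_modelCurve s hε hε1 hvq1 hq0 hk100 hqk h0 ht (by linarith)
      (h.near_model hw.2)
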